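/- Let $O_3=\mathbb{Z}+\mathbb{Z}\omega$, with $\omega=\frac{1+\sqrt{-3}}{2}$, be the ring of integers of $\mathbb{Q}(\sqrt{-3})$, let $O_{3,2}=\mathbb{Z}+2\omega\mathbb{Z}$, and let $\Gamma_3=PSL_2(O_3)$. Let $D(3,3,3)=\langle x,y\mid x^3=y^3=(xy)^3=1\rangle$, and let $K_{3,2}=S_3\ast_{\mathbb{Z}/3\mathbb{Z}}D(3,3,3)$ be the amalgamated free product in which the subgroup of order $3$ of $S_3$ is identified with the subgroup $\langle y\rangle$ of order $3$ of $D(3,3,3)$. Then the homomorphism $PSL_2(O_{3,2})\to\Gamma_3$ induced by the inclusion $O_{3,2}\subset O_3$ is injective, and its image $\Gamma_{3,2}$, identified with $PSL_2(O_{3,2})$, is a subgroup of finite index in $\Gamma_3$. Moreover $\Gamma_{3,2}$ is an HNN-extension of $K_{3,2}$ whose associated subgroups are isomorphic to the modular group: there are subgroups $A,B\le K_{3,2}$, both isomorphic to $PSL_2(\mathbb{Z})$, and an isomorphism $\varphi:A\to B$ such that $$\Gamma_{3,2}\;\cong\;\langle K_{3,2},\,w\mid w a w^{-1}=\varphi(a)\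 (a\in A)\rangle .$$ -/

import Mathlib

open scoped MatrixGroups

noncomputable section

/-- The imaginary quadratic field `ℚ(√-3)`, as a subfield of `ℂ`. -/
abbrev QSqrtNeg3 : IntermediateField ℚ ℂ :=
  IntermediateField.adjoin ℚ {((Real.sqrt 3 : ℝ) : ℂ) * Complex.I}

/-- `O₃`, the ring of integers of `ℚ(√-3)`. -/
abbrev O3 : Type := NumberField.RingOfIntegers QSqrtNeg3

/-- The complex number `(1 + √-3) / 2`. -/
def omegaC : ℂ := (1 + ((Real.sqrt 3 : ℝ) : ℂ) * Complex.I) / 2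

theorem omegaC_sq : omegaC ^ 2 = omegaC - 1 := by
  have h : ((Real.sqrt 3 : ℝ) : ℂ) ^ 2 = 3 := by
    rw [← Complex.ofReal_pow, Real.sq_sqrt (by norm_num)]
    norm_num
  unfold omegaC
  linear_combination (1 / 4 : ℂ) * ((Real.sqrt 3 : ℝ) : ℂ) ^ 2 * Complex.I_sq - (1 / 4 : ℂ) * h

theorem omegaC_mem : omegaC ∈ QSqrtNeg3 := by
  have h : ((Real.sqrt 3 : ℝ) : ℂ) * Complex.I ∈ QSqrtNeg3 :=
    IntermediateField.mem_adjoin_simple_self ℚ _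
  exact div_mem (add_mem (one_mem _) h) (ofNat_mem QSqrtNeg3 2)

theorem omega_isIntegral : IsIntegral ℤ (⟨omegaC, omegaC_mem⟩ : QSqrtNeg3) := by
  refine ⟨Polynomial.X ^ 2 - Polynomial.X + 1, by monicity!, ?_⟩
  have h : (⟨omegaC, omegaC_mem⟩ : QSqrtNeg3) ^ 2 = ⟨omegaC, omegaC_mem⟩ - 1 :=
    Subtype.ext omegaC_sq
  simp [h]

/-- `ω = (1 + √-3) / 2` as an element of `O₃`. -/
def omega : O3 := ⟨⟨omegaC, omegaC_mem⟩, omega_isIntegral⟩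

theorem omega_sq : omega ^ 2 = omega - 1 :=
  NumberField.RingOfIntegers.ext (Subtype.ext omegaC_sq)

/-- The order `O_{3,m} = ℤ + mωℤ` of `O₃`. -/
def O3m (m : ℕ) : Subring O3 where
  carrier := {x | ∃ a b : ℤ, x = (a : O3) + (m : O3) * omega * (b : O3)}
  zero_mem' := ⟨0, 0, by simp⟩
  one_mem' := ⟨1, 0, by simp⟩
  add_mem' := by
    rintro _ _ ⟨a, b, rfl⟩ ⟨c, d, rfl⟩
    exact ⟨a + c, b + d, by push_cast; ring⟩
  neg_mem' := by
    rintro _ ⟨a, b, rfl⟩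
    exact ⟨-a, -b, by push_cast; ring⟩
  mul_mem' := by
    rintro _ _ ⟨a, b, rfl⟩ ⟨c, d, rfl⟩
    refine ⟨a * c - m ^ 2 * b * d, a * d + b * c + m * b * d, ?_⟩
    push_cast
    linear_combination (m : O3) ^ 2 * b * d * omega_sq

/-- The homomorphism `PSL₂(R) → PSL₂(S)` induced by a ring homomorphism `R → S`. -/
def pslMap {R S : Type} [CommRing R] [CommRing S] (f : R →+* S) : PSL(2, R) →* PSL(2, S) :=
  QuotientGroup.map _ _ (Matrix.SpecialLinearGroup.map f) (by
    intro A hA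
    rw [Matrix.SpecialLinearGroup.mem_center_iff] at hA
    obtain ⟨r, hr, hA⟩ := hA
    rw [Subgroup.mem_comap, Matrix.SpecialLinearGroup.mem_center_iff]
    refine ⟨f r, by rw [← map_pow, hr, map_one], ?_⟩
    rw [Matrix.SpecialLinearGroup.map_apply_coe, ← hA]
    ext i j
    by_cases h : i = j <;> simp [Matrix.scalar_apply, h])

/-- The subgroup `Γ_{3,2} = PSL₂(O_{3,2})` of `Γ₃ = PSL₂(O₃)`: the image of the homomorphism
induced by the inclusion of `O_{3,2}` in `O₃`. -/
def Gamma32 : Subgroup PSL(2, O3) := (pslMap (O3m 2).subtype).range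

/-- The relators of the presentation `⟨x, y | x³ = y³ = (xy)³ = 1⟩`, with `x` the free generator
`0` and `y` the free generator `1`. -/
def relsD333 : Set (FreeGroup (Fin 2)) :=
  {FreeGroup.of 0 ^ 3, FreeGroup.of 1 ^ 3, (FreeGroup.of 0 * FreeGroup.of 1) ^ 3}

/-- The triangle group `D(3,3,3) = ⟨x, y | x³ = y³ = (xy)³ = 1⟩`. -/
abbrev D333 : Type := PresentedGroup relsD333

/-- The generator `y` of `D(3,3,3)`. -/
def D333.y : D333 := PresentedGroup.of 1

theorem D333.y_pow_three : D333.y ^ 3 = 1 :=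
  PresentedGroup.one_of_mem (rels := relsD333) (x := FreeGroup.of 1 ^ 3) (by simp [relsD333])

/-- For `g` with `g³ = 1`, the homomorphism from the cyclic group of order three that sends the
generator to `g`. -/
def zmod3Hom {G : Type} [Group G] (g : G) (hg : g ^ 3 = 1) : Multiplicative (ZMod 3) →* G :=
  AddMonoidHom.toMultiplicativeLeft (ZMod.lift 3
    ⟨AddMonoidHom.toMultiplicativeLeft.symm (zpowersHom G g), by
      apply Additive.toMul.injective
      simpa using (by exact_mod_cast hg : g ^ (3 : ℤ) = 1)⟩)

theorem zmod3Hom_ofAdd_one {G : Type} [Group G] (g : G) (hg : g ^ 3 = 1) :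
    zmod3Hom g hg (Multiplicative.ofAdd 1) = g := by
  have h := ZMod.lift_coe 3 (⟨AddMonoidHom.toMultiplicativeLeft.symm (zpowersHom G g), by
      apply Additive.toMul.injective
      simpa using (by exact_mod_cast hg : g ^ (3 : ℤ) = 1)⟩ :
        { f : ℤ →+ Additive G // f (3 : ℕ) = 0 }) 1
  simpa [zmod3Hom] using congrArg Additive.toMul h

/-- The two factors of the amalgamated product: `S₃` and `D(3,3,3)`. -/
abbrev Factor : Fin 2 → Type
  | 0 => Equiv.Perm (Fin 3)
  | 1 => D333

instance : (i : Fin 2) → Group (Factor i)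
  | 0 => inferInstanceAs (Group (Equiv.Perm (Fin 3)))
  | 1 => inferInstanceAs (Group D333)

/-- The embeddings of the amalgamated group `ℤ/3`: a generator is sent to a 3-cycle in `S₃` and to
`y` in `D(3,3,3)`. -/
def factorMap : (i : Fin 2) → Multiplicative (ZMod 3) →* Factor i
  | 0 => zmod3Hom (finRotate 3) (by decide)
  | 1 => zmod3Hom D333.y D333.y_pow_three

/-- `K_{3,2} = S₃ ∗_{ℤ/3} D(3,3,3)`. -/
abbrev K32 : Type := Monoid.PushoutI factorMap

end

/-! The core is a recognition criterion. Let `G` be generated by `S`, `X`, `w`, let `HNNRelations S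
X Y w` hold, and let `f : G →* PSL(2, Eis)` send `S` to the Weyl element, `X` to `T(1)S` and `w` to
the translation by `√-3`. Then `f` is injective, and its image is the group of matrices over `ℤ[√-3]
= O_{3,2}`. The HNN-extension is such a group.

For injectivity, left multiplication of `G` on itself is induced up to `PSL₂(ℤ[ω])`. A point `(x,
g)` of `Fin 10 × G` stands for `r_x f(g)`, with `r_x` a coset representative; ten is the index of
`SL₂(𝔽₂)` in `SL₂(𝔽₄)`, by reduction modulo 2. Each generator of `PSL₂(ℤ[ω])` permutes the indices
and multiplies the second coordinate by a word in `S`, `X`, `Y`, `w`. The defining relations of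
`PSL₂(ℤ[ω])` hold for these permutations as a consequence of `HNNRelations` alone, so the action
exists (`Eis.exists_inducedAction`). Over the trivial coset `f g` acts as left multiplication by
`g`, hence `f` has trivial kernel (`Eis.injective_of_hnnRelations`). Comparing the action with
matrix multiplication shows that every element is some `r_x f(g)` (`Eis.exists_cosetRep_mul`), which
gives the finite index and the image.

This needs a presentation of `PSL₂(ℤ[ω])`. It is supplied by `exists_hom_psl`, valid over every
domain with a sufficiently connected Euclidean division: the Euclidean algorithm on columns yields
an equivariant map to cosets of the Borel subgroup (`cuspEquivariant`), so a word with trivial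
matrix lies in the Borel subgroup, where it is visibly trivial. Over `ℤ` the same presentation
produces two homomorphisms from `PSL₂(ℤ)` to `K32`. They become conjugates of the inclusion in
`PSL₂(ℤ[ω])`, so they are injective, and their ranges are the associated subgroups
(`K32.exists_modular_embeddings`). -/

noncomputable section

/-! ### Elementary matrices -/

section Elementary

variable {R : Type} [CommRing R]

/-- The elementary matrix with upper right entry `b`. -/
def slT (b : R) : SL(2, R) := ⟨!![1, b; 0, 1], by simp⟩

/-- The Weyl element of `SL₂`. -/
def slS : SL(2, R) := ⟨!![0, -1; 1, 0], by simp⟩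

/-- The diagonal matrix with entries `u` and `u⁻¹`. -/
def slD (u : Rˣ) : SL(2, R) := ⟨!![(u : R), 0; 0, ((u⁻¹ : Rˣ) : R)], by simp⟩

@[simp] theorem coe_slT (b : R) : (slT b : Matrix (Fin 2) (Fin 2) R) = !![1, b; 0, 1] := rfl

@[simp] theorem coe_slS : ((slS : SL(2, R)) : Matrix (Fin 2) (Fin 2) R) = !![0, -1; 1, 0] := rfl

@[simp] theorem coe_slD (u : Rˣ) :
    (slD u : Matrix (Fin 2) (Fin 2) R) = !![(u : R), 0; 0, ((u⁻¹ : Rˣ) : R)] := rfl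

/-- The class of a matrix in `PSL₂`. -/
def pslMk : SL(2, R) →* PSL(2, R) := QuotientGroup.mk' _

theorem pslMk_surjective : Function.Surjective (pslMk (R := R)) :=
  QuotientGroup.mk'_surjective _

theorem pslMk_neg (A : SL(2, R)) : pslMk (-A) = pslMk A := by
  have h : pslMk (-1 : SL(2, R)) = 1 := by
    refine (QuotientGroup.eq_one_iff _).2 ?_
    rw [Matrix.SpecialLinearGroup.mem_center_iff]
    exact ⟨-1, by simp, by simp [← Matrix.diagonal_neg]⟩
  rw [← neg_one_mul, map_mul, h, one_mul]

theorem pslMk_eq_one_iff [IsDomain R] {A : SL(2, R)} : pslMk A = 1 ↔ A = 1 ∨ A = -1 := by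
  constructor
  · intro h
    have h' := (QuotientGroup.eq_one_iff _).1 h
    rw [Matrix.SpecialLinearGroup.mem_center_iff] at h'
    obtain ⟨r, hr, hA⟩ := h'
    have hr' : r ^ 2 = 1 := by simpa using hr
    rcases sq_eq_one_iff.1 hr' with rfl | rfl
    · left
      exact Subtype.ext (by simpa using hA.symm)
    · right
      exact Subtype.ext (by simpa [← Matrix.diagonal_neg] using hA.symm)
  · rintro (rfl | rfl)
    · exact map_one _
    · rw [pslMk_neg, map_one]

theorem slT_add (a b : R) : slT (a + b) = slT a * slT b := by
  ext i j
  fin_cases i <;> fin_cases j <;>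
    simp [Matrix.SpecialLinearGroup.coe_mul, Matrix.mul_fin_two, -Matrix.cons_mul, add_comm]

theorem slD_mul (a b : Rˣ) : slD (a * b) = slD a * slD b := by
  ext i j
  fin_cases i <;> fin_cases j <;>
    simp [Matrix.SpecialLinearGroup.coe_mul, Matrix.mul_fin_two, -Matrix.cons_mul, mul_comm]

/-- Translations, as a homomorphism to `PSL₂`. -/
def pslT : Multiplicative R →* PSL(2, R) :=
  MonoidHom.mk' (fun b => pslMk (slT b.toAdd)) fun a b => by
    rw [toAdd_mul, slT_add, map_mul]

/-- Diagonal matrices, as a homomorphism to `PSL₂`. -/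
def pslD : Rˣ →* PSL(2, R) :=
  MonoidHom.mk' (fun u => pslMk (slD u)) fun a b => by
    rw [slD_mul, map_mul]

/-- The involution of `PSL₂` given by the Weyl element. -/
def pslS : PSL(2, R) := pslMk slS

/-- The relations between translations, diagonal matrices and the Weyl element that hold in
`PSL₂(R)`. -/
structure ElementaryRelations {W : Type} [Group W] (T : Multiplicative R →* W) (D : Rˣ →* W)
    (s : W) : Prop where
  s_mul_s : s * s = 1
  D_neg_one : D (-1) = 1
  D_mul_T (u : Rˣ) (b : R) : D u * T (.ofAdd b) = T (.ofAdd (u ^ 2 * b)) * D u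
  D_mul_s (u : Rˣ) : D u * s = s * D u⁻¹
  s_T_s (u : Rˣ) : s * T (.ofAdd (u : R)) * s =
    T (.ofAdd (-(u⁻¹ : Rˣ) : R)) * s * D u * T (.ofAdd (-(u⁻¹ : Rˣ) : R))

theorem elementaryRelations_psl : ElementaryRelations (R := R) pslT pslD pslS where
  s_mul_s := by
    rw [pslS, ← map_mul, ← pslMk_neg, ← map_one pslMk]
    congr 1
    ext i j
    fin_cases i <;> fin_cases j <;>
      simp [Matrix.SpecialLinearGroup.coe_mul, Matrix.mul_fin_two, -Matrix.cons_mul]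
  D_neg_one := by
    rw [← map_one pslMk, ← pslMk_neg]
    show pslMk _ = _
    congr 1
    ext i j
    fin_cases i <;> fin_cases j <;>
    simp [-Matrix.cons_mul]
  D_mul_T u b := by
    show pslMk _ * pslMk _ = pslMk _ * pslMk _
    rw [← map_mul, ← map_mul]
    congr 1
    ext i j
    fin_cases i <;> fin_cases j <;>
      simp [Matrix.SpecialLinearGroup.coe_mul, Matrix.mul_fin_two, -Matrix.cons_mul]
    linear_combination (- (u : R) * b) * u.mul_inv
  D_mul_s u := by
    show pslMk _ * pslMk _ = pslMk _ * pslMk _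
    rw [← map_mul, ← map_mul]
    congr 1
    ext i j
    fin_cases i <;> fin_cases j <;>
      simp [Matrix.SpecialLinearGroup.coe_mul, Matrix.mul_fin_two, -Matrix.cons_mul]
  s_T_s u := by
    show pslMk _ * pslMk _ * pslMk _ = pslMk _ * pslMk _ * pslMk _ * pslMk _
    simp only [← map_mul]
    congr 1
    ext i j
    fin_cases i <;> fin_cases j <;>
      simp [Matrix.SpecialLinearGroup.coe_mul, Matrix.mul_fin_two, -Matrix.cons_mul]

end Elementary

/-! ### Euclidean rings whose quotients are connected by unit steps. -/

/-- A ring with a norm function for which division with remainder is possible, any two quotients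
of a division are connected by a chain of at most two unit steps, and elements of equal norm
can be reduced by a unit. -/
structure IsUnitEuclidean (R : Type) [CommRing R] (N : R → ℕ) : Prop where
  zero_lt {x : R} : x ≠ 0 → 0 < N x
  map_zero : N 0 = 0
  unit_mul (u : Rˣ) (x : R) : N (u * x) = N x
  exists_quot (a : R) {c : R} : c ≠ 0 → ∃ q, N (a - q * c) < N c
  connected {a c q q' : R} : N (a - q * c) < N c → N (a - q' * c) < N c → q' ≠ q →
    (∃ u : Rˣ, q' = q + u) ∨ ∃ u u' : Rˣ, q' = q + u + u' ∧ N (a - (q + u) * c) < N c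
  exists_unit {a c : R} : c ≠ 0 → N a = N c → ∃ u : Rˣ, N (a - u * c) < N c

namespace IsUnitEuclidean

variable {R : Type} [CommRing R] {N : R → ℕ} (hN : IsUnitEuclidean R N)
include hN

theorem map_neg (x : R) : N (-x) = N x := by
  simpa using hN.unit_mul (-1) x

end IsUnitEuclidean

/-! ### A presentation of `PSL₂` from the Euclidean algorithm on columns. -/

section Cusp

open Classical in
/-- The coset attached to the column `(a, c)` by the Euclidean algorithm. -/
def cuspCoset {R : Type} [CommRing R] {N : R → ℕ} (hN : IsUnitEuclidean R N) {W : Type} [Group W]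
    (T : Multiplicative R →* W) (s : W) (B : Subgroup W) (a c : R) : W ⧸ B :=
  if hc : c = 0 then ((1 : W) : W ⧸ B)
  -- As columns, `T(q) s` sends `(-c, a - qc)` to `-(a, c)`, and signs do not matter in `PSL₂`.
  else (T (.ofAdd (hN.exists_quot a hc).choose) * s) •
    cuspCoset hN T s B (-c) (a - (hN.exists_quot a hc).choose * c)
termination_by N c
decreasing_by exact (hN.exists_quot a hc).choose_spec

variable {R : Type} [CommRing R] {N : R → ℕ} (hN : IsUnitEuclidean R N) {W : Type} [Group W]
  {T : Multiplicative R →* W} {D : Rˣ →* W} {s : W} (h : ElementaryRelations T D s)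
  {B : Subgroup W} (hT : ∀ b, T b ∈ B) (hD : ∀ u, D u ∈ B)

theorem cuspCoset_zero (a : R) : cuspCoset hN T s B a 0 = ((1 : W) : W ⧸ B) := by
  rw [cuspCoset, dif_pos rfl]

theorem smul_coset_one {G : Type} [Group G] {B : Subgroup G} {g : G} (hg : g ∈ B) :
    g • ((1 : G) : G ⧸ B) = ((1 : G) : G ⧸ B) := by
  rw [MulAction.Quotient.smul_coe, smul_eq_mul, mul_one]
  exact (QuotientGroup.eq.2 (by simpa using hg)).symm

theorem cuspCoset_exists (a : R) {c : R} (hc : c ≠ 0) : ∃ q, N (a - q * c) < N c ∧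
    cuspCoset hN T s B a c = (T (.ofAdd q) * s) • cuspCoset hN T s B (-c) (a - q * c) := by
  refine ⟨(hN.exists_quot a hc).choose, (hN.exists_quot a hc).choose_spec, ?_⟩
  rw [cuspCoset, dif_neg hc]

/-- Equivariance of `cuspCoset` on columns whose entries have norm less than `n`. -/
structure CuspEquivariant (T : Multiplicative R →* W) (D : Rˣ →* W) (s : W) (B : Subgroup W)
    (n : ℕ) : Prop where
  quot {a c q : R} : N c < n → N (a - q * c) < N c →
    cuspCoset hN T s B a c = (T (.ofAdd q) * s) • cuspCoset hN T s B (-c) (a - q * c)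
  unit (u : Rˣ) {a c : R} : N c < n → cuspCoset hN T s B (u * a) (u * c) = cuspCoset hN T s B a c
  trans (b : R) {a c : R} : N c < n →
    T (.ofAdd b) • cuspCoset hN T s B a c = cuspCoset hN T s B (a + b * c) c
  diag (u : Rˣ) {a c : R} : N c < n →
    D u • cuspCoset hN T s B a c = cuspCoset hN T s B (u * a) ((u⁻¹ : Rˣ) * c)
  weyl {a c : R} : N a < n → N c < n → (a ≠ 0 ∨ c ≠ 0) →
    s • cuspCoset hN T s B a c = cuspCoset hN T s B (-c) a

include h in
theorem ElementaryRelations.smul_s_T_s {X : Type} [MulAction W X] (u : Rˣ) (x : X) :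
    s • T (.ofAdd (u : R)) • s • x =
      T (.ofAdd (-(u⁻¹ : Rˣ) : R)) • s • D u • T (.ofAdd (-(u⁻¹ : Rˣ) : R)) • x := by
  simp only [← mul_smul, ← mul_assoc, h.s_T_s u]

include h in
theorem ElementaryRelations.s_smul_s_smul {X : Type} [MulAction W X] (x : X) : s • s • x = x := by
  rw [← mul_smul, h.s_mul_s, one_smul]

variable {n : ℕ} (H : CuspEquivariant hN T D s B n)

include H in
theorem CuspEquivariant.unit_neg {a c : R} (hc : N c < n) :
    cuspCoset hN T s B (-a) (-c) = cuspCoset hN T s B a c := by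
  simpa using H.unit (-1) (a := a) hc

include h H in
/-- Moving the quotient by a unit does not change the coset. -/
theorem CuspEquivariant.unit_step {c r : R} (u : Rˣ) (hc : N c = n) (hr : N r < n)
    (hr' : N (r - u * c) < n) :
    s • cuspCoset hN T s B (-c) r =
      T (.ofAdd (u : R)) • s • cuspCoset hN T s B (-c) (r - u * c) := by
  have hc0 : c ≠ 0 := by
    rintro rfl
    rw [hN.map_zero] at hc
    omega
  have hne : -((u⁻¹ : Rˣ) : R) * r ≠ 0 ∨ ((u⁻¹ : Rˣ) : R) * (r - u * c) ≠ 0 := by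
    by_contra! hcon
    apply hc0
    have h1 : r = 0 := by simpa using hcon.1
    have h2 := hcon.2
    rw [h1] at h2
    simpa using h2
  have hnu (x : R) : N ((u⁻¹ : Rˣ) * x) = N x := hN.unit_mul _ _
  have hnu' (x : R) : N (-(u⁻¹ : Rˣ) * x) = N x := by rw [neg_mul, hN.map_neg, hnu]
  -- After rewriting `s T(u) s` by the last elementary relation, the column passes through `(-u⁻¹r,
  -- r - uc)`, `(-r, u⁻¹(r - uc))`, `(-u⁻¹(r - uc), -r)` and `(c, -r)`. Every lower entry has norm
  -- below `n`, and so have both entries where `s` acts, so the induction hypothesis covers each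
  -- move.
  have key : s • T (.ofAdd (u : R)) • s • cuspCoset hN T s B (-c) (r - u * c) =
      cuspCoset hN T s B (-c) r := by
    rw [h.smul_s_T_s, H.trans _ hr', H.diag u hr']
    have e1 : (u : R) * (-c + -((u⁻¹ : Rˣ) : R) * (r - u * c)) = -r := by
      linear_combination (-r + u * c) * u.mul_inv
    rw [e1]
    rw [H.weyl (by rwa [hN.map_neg]) (by rwa [hnu])
      (by
        rcases hne with hne | hne
        · left
          intro h0
          apply hne
          rw [neg_mul, ← mul_neg, h0, mul_zero]
        · exact .inr hne), H.trans _ (by rwa [hN.map_neg])]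
    have e2 : -(((u⁻¹ : Rˣ) : R) * (r - u * c)) + -((u⁻¹ : Rˣ) : R) * -r = c := by
      linear_combination c * u.inv_mul
    rw [e2]
    simpa using H.unit_neg hN (a := -c) (c := r) hr
  rw [← key, h.s_smul_s_smul]

-- Induction on the norm of the lower entry. The point is independence of the chosen quotient: two
-- admissible quotients are joined by at most two unit steps through admissible ones, and each step
-- is `CuspEquivariant.unit_step`. With the quotient free, units, translations and diagonal elements
-- merely transport one division to another. For the Weyl element the quotient 0 works when the
-- upper entry is smaller.
include h hT hD in
theorem cuspEquivariant (n : ℕ) : CuspEquivariant hN T D s B n := by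
  induction n with
  | zero => constructor <;> intros <;> omega
  | succ n H =>
    have quot {a c q : R} (hc : N c < n + 1) (hq : N (a - q * c) < N c) :
        cuspCoset hN T s B a c = (T (.ofAdd q) * s) • cuspCoset hN T s B (-c) (a - q * c) := by
      rcases (Nat.lt_succ_iff_lt_or_eq.1 hc) with hc | hc
      · exact H.quot hc hq
      have hc0 : c ≠ 0 := by
        rintro rfl
        rw [hN.map_zero] at hq
        omega
      have step {q : R} (u : Rˣ) (h1 : N (a - q * c) < N c) (h2 : N (a - (q + u) * c) < N c) :
          (T (.ofAdd (q + u)) * s) • cuspCoset hN T s B (-c) (a - (q + u) * c) =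
          (T (.ofAdd q) * s) • cuspCoset hN T s B (-c) (a - q * c) := by
        have e : a - (q + u) * c = a - q * c - u * c := by ring
        rw [e] at h2 ⊢
        rw [mul_smul, mul_smul _ _ (cuspCoset hN T s B (-c) (a - q * c)),
          H.unit_step hN h (r := a - q * c) u hc (by omega) (by omega), ofAdd_add, map_mul,
            mul_smul]
      obtain ⟨q', hq', e⟩ := cuspCoset_exists hN (T := T) (s := s) (B := B) a hc0
      rw [e]
      by_cases hqq : q' = q
      · rw [hqq]
      rcases hN.connected hq hq' hqq with ⟨u, rfl⟩ | ⟨u, u', rfl, h1⟩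
      · exact step u hq hq'
      · rw [step u' h1 hq', step u hq h1]
    have unit (u : Rˣ) {a c : R} (hc : N c < n + 1) :
        cuspCoset hN T s B (u * a) (u * c) = cuspCoset hN T s B a c := by
      by_cases hc0 : c = 0
      · rw [hc0, mul_zero, cuspCoset_zero, cuspCoset_zero]
      obtain ⟨q, hq, e⟩ := cuspCoset_exists hN (T := T) (s := s) (B := B) a hc0
      have e1 : u * a - q * (u * c) = u * (a - q * c) := by ring
      rw [e, quot (q := q) (by rwa [hN.unit_mul]) (by rwa [e1, hN.unit_mul, hN.unit_mul]), e1,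
        ← mul_neg, H.unit u (by omega)]
    have trans (b : R) {a c : R} (hc : N c < n + 1) :
        T (.ofAdd b) • cuspCoset hN T s B a c = cuspCoset hN T s B (a + b * c) c := by
      by_cases hc0 : c = 0
      · rw [hc0, cuspCoset_zero, cuspCoset_zero, smul_coset_one (hT _)]
      obtain ⟨q, hq, e⟩ := cuspCoset_exists hN (T := T) (s := s) (B := B) a hc0
      have e1 : a + b * c - (b + q) * c = a - q * c := by ring
      rw [e, quot (a := a + b * c) (q := b + q) hc (by rwa [e1]), e1, ofAdd_add, map_mul,
        ← mul_smul, mul_assoc]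
    have diag (u : Rˣ) {a c : R} (hc : N c < n + 1) :
        D u • cuspCoset hN T s B a c = cuspCoset hN T s B (u * a) ((u⁻¹ : Rˣ) * c) := by
      by_cases hc0 : c = 0
      · rw [hc0, mul_zero, cuspCoset_zero, cuspCoset_zero, smul_coset_one (hD u)]
      obtain ⟨q, hq, e⟩ := cuspCoset_exists hN (T := T) (s := s) (B := B) a hc0
      have e1 : u * a - (u ^ 2 * q) * ((u⁻¹ : Rˣ) * c) = u * (a - q * c) := by
        linear_combination (- (u : R) * q * c) * u.mul_inv
      rw [e, quot (a := u * a) (q := u ^ 2 * q) (by rwa [hN.unit_mul])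
        (by rwa [e1, hN.unit_mul, hN.unit_mul]), e1, ← mul_smul, ← mul_assoc, h.D_mul_T,
        mul_assoc, h.D_mul_s, ← mul_assoc, mul_smul, H.diag _ (by omega), inv_inv, mul_neg]
    have weyl_lt {a c : R} (hc : N c < n + 1) (ha : N a < N c) :
        s • cuspCoset hN T s B a c = cuspCoset hN T s B (-c) a := by
      rw [quot (a := a) (q := 0) hc (by simpa), ofAdd_zero, map_one, one_mul, zero_mul, sub_zero,
        h.s_smul_s_smul]
    refine ⟨quot, unit, trans, diag, fun {a c} ha hc hne => ?_⟩
    rcases lt_trichotomy (N a) (N c) with hac | hac | hac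
    · exact weyl_lt hc hac
    -- Equal norms: neither entry can be divided with quotient 0. A unit quotient `u` for `(a, c)`
    -- corresponds to the quotient `-u⁻¹` for `(-c, a)`, and the relation for `s T(u) s` matches the
    -- two divisions.
    · have hc0 : c ≠ 0 := by
        rintro rfl
        rw [hN.map_zero] at hac
        rcases hne with hne | hne
        · exact absurd (hN.zero_lt hne) (by omega)
        · exact hne rfl
      rcases (Nat.lt_succ_iff_lt_or_eq.1 hc) with hc | hc
      · exact H.weyl (by omega) hc hne
      obtain ⟨u, hu⟩ := hN.exists_unit hc0 hac
      have e3 : -c - -((u⁻¹ : Rˣ) : R) * a = (u⁻¹ : Rˣ) * (a - u * c) := by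
        linear_combination c * u.inv_mul
      rw [quot (a := a) (q := (u : R)) (by omega) hu, mul_smul, h.smul_s_T_s,
        H.trans _ (by omega), H.diag _ (by omega),
        quot (a := -c) (c := a) (q := -((u⁻¹ : Rˣ) : R)) ha (by rw [e3, hN.unit_mul]; omega), e3,
        mul_smul]
      have e1 : (u : R) * (-c + -((u⁻¹ : Rˣ) : R) * (a - u * c)) = -a := by
        linear_combination (-a + u * c) * u.mul_inv
      rw [e1]
    -- The previous case applied to `(-c, a)`, with `s² = 1`.
    · have := weyl_lt (a := -c) (c := a) ha (by rwa [hN.map_neg])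
      have e : cuspCoset hN T s B (-a) (-c) = cuspCoset hN T s B a c := by
        simpa using unit (-1) (a := a) hc
      rw [← e, ← this, h.s_smul_s_smul]

/-- The subset of translations, diagonal elements and the Weyl element. -/
def elementarySet (T : Multiplicative R →* W) (D : Rˣ →* W) (s : W) : Set W :=
  Set.range T ∪ Set.range D ∪ {s}

include h hT hD in
/-- An element of the group generated by `T`, `D` and `s` acts on the cosets `cuspCoset` through
a matrix that represents its image in `PSL₂`. -/
theorem exists_matrix_smul_cuspCoset {φ : W →* PSL(2, R)} (hφT : ∀ b, φ (T b) = pslT b)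
    (hφD : ∀ u, φ (D u) = pslD u) (hφs : φ s = pslS) {w : W}
    (hw : w ∈ Subgroup.closure (elementarySet T D s)) :
    ∃ M : SL(2, R), φ w = pslMk M ∧ ∀ v : Fin 2 → R, v ≠ 0 →
      w • cuspCoset hN T s B (v 0) (v 1) =
        cuspCoset hN T s B ((M.1.mulVec v) 0) ((M.1.mulVec v) 1) := by
  have hne (M : SL(2, R)) {v : Fin 2 → R} (hv : v ≠ 0) : M.1.mulVec v ≠ 0 := by
    intro h0
    apply hv
    have := congrArg ((M⁻¹).1.mulVec) h0
    rwa [Matrix.mulVec_mulVec, ← Matrix.SpecialLinearGroup.coe_mul, inv_mul_cancel,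
      Matrix.SpecialLinearGroup.coe_one, Matrix.one_mulVec, Matrix.mulVec_zero] at this
  induction hw using Subgroup.closure_induction with
  | mem w hw =>
    rcases hw with (⟨b, rfl⟩ | ⟨u, rfl⟩) | rfl
    · refine ⟨slT b.toAdd, hφT b, fun v _ => ?_⟩
      have := (cuspEquivariant hN h hT hD (N (v 1) + 1)).trans b.toAdd (a := v 0) (c := v 1)
        (by omega)
      simpa [Matrix.mulVec_eq_sum, mul_comm] using this
    · refine ⟨slD u, hφD u, fun v _ => ?_⟩
      have := (cuspEquivariant hN h hT hD (N (v 1) + 1)).diag u (a := v 0) (c := v 1)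
        (by omega)
      simpa [Matrix.mulVec_eq_sum, mul_comm] using this
    · refine ⟨slS, hφs, fun v hv => ?_⟩
      have := (cuspEquivariant hN h hT hD (N (v 0) + N (v 1) + 1)).weyl (a := v 0) (c := v 1)
        (by omega) (by omega) (by
          by_contra! h0
          exact hv (funext fun i => by fin_cases i <;> simp [h0]))
      simpa [Matrix.mulVec_eq_sum] using this
  | one => exact ⟨1, by simp, by simp⟩
  | mul x y _ _ hx hy =>
    obtain ⟨M, hM, hx⟩ := hx
    obtain ⟨M', hM', hy⟩ := hy
    refine ⟨M * M', by rw [map_mul, map_mul, hM, hM'], fun v hv => ?_⟩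
    rw [mul_smul, hy v hv, hx _ (hne M' hv), Matrix.mulVec_mulVec]
    rfl
  | inv x _ hx =>
    obtain ⟨M, hM, hx⟩ := hx
    refine ⟨M⁻¹, by rw [map_inv, map_inv, hM], fun v hv => ?_⟩
    rw [inv_smul_eq_iff, hx _ (hne M⁻¹ hv), Matrix.mulVec_mulVec,
      ← Matrix.SpecialLinearGroup.coe_mul, mul_inv_cancel, Matrix.SpecialLinearGroup.coe_one,
      Matrix.one_mulVec]

/-- The subgroup of products of a translation and a diagonal element. -/
def ElementaryRelations.borel (h : ElementaryRelations T D s) : Subgroup W where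
  carrier := {w | ∃ b u, w = T b * D u}
  one_mem' := ⟨1, 1, by simp⟩
  mul_mem' := by
    rintro _ _ ⟨b, u, rfl⟩ ⟨b', u', rfl⟩
    refine ⟨b * .ofAdd (u ^ 2 * b'.toAdd), u * u', ?_⟩
    have := h.D_mul_T u b'.toAdd
    rw [ofAdd_toAdd] at this
    rw [T.map_mul, D.map_mul, mul_assoc, ← mul_assoc (D u), this]
    simp only [mul_assoc]
  inv_mem' := by
    rintro _ ⟨b, u, rfl⟩
    refine ⟨.ofAdd ((u⁻¹ : Rˣ) ^ 2 * (b⁻¹).toAdd), u⁻¹, ?_⟩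
    rw [← h.D_mul_T, ofAdd_toAdd, mul_inv_rev, map_inv, map_inv]

-- A trivial image means that the representing matrix is `±1`, which fixes the column `(1, 0)`. Its
-- coset is the trivial one, so `w` lies in the Borel subgroup, where the matrix entries determine
-- `b` and determine `u` up to sign.
include hN h in
theorem eq_one_of_map_eq_one [IsDomain R] {φ : W →* PSL(2, R)} (hφT : ∀ b, φ (T b) = pslT b)
    (hφD : ∀ u, φ (D u) = pslD u) (hφs : φ s = pslS) {w : W}
    (hw : w ∈ Subgroup.closure (elementarySet T D s)) (hw1 : φ w = 1) : w = 1 := by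
  have hT (b) : T b ∈ h.borel := ⟨b, 1, by simp⟩
  have hD (u) : D u ∈ h.borel := ⟨1, u, by simp⟩
  obtain ⟨M, hM, hv⟩ := exists_matrix_smul_cuspCoset hN h hT hD hφT hφD hφs hw
  have hmem : w ∈ h.borel := by
    have := hv ![1, 0] (by simp)
    have h0 : M.1.mulVec ![1, 0] 1 = 0 := by
      rcases pslMk_eq_one_iff.1 (hM ▸ hw1) with rfl | rfl <;> simp [Matrix.mulVec_eq_sum]
    have h1 : (![1, 0] : Fin 2 → R) 1 = 0 := rfl
    rw [h0, h1, cuspCoset_zero, cuspCoset_zero,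
      MulAction.Quotient.smul_coe, smul_eq_mul, mul_one] at this
    simpa using QuotientGroup.eq.1 this
  obtain ⟨b, u, rfl⟩ := hmem
  have h1 : pslMk (slT b.toAdd * slD u) = 1 := by
    rw [map_mul, ← hw1, map_mul, hφT, hφD]
    rfl
  have hb (x : R) (hx : x * (u⁻¹ : Rˣ) = 0) : x = 0 := by
    simpa using hx
  rcases pslMk_eq_one_iff.1 h1 with h2 | h2
  · have e00 := congrArg (fun A : SL(2, R) => A.1 0 0) h2
    have e01 := congrArg (fun A : SL(2, R) => A.1 0 1) h2
    simp [Matrix.mul_fin_two, -Matrix.cons_mul] at e00 e01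
    have hb : b = 1 := e01
    rw [hb, e00, map_one, map_one, one_mul]
  · have e00 := congrArg (fun A : SL(2, R) => A.1 0 0) h2
    have e01 := congrArg (fun A : SL(2, R) => A.1 0 1) h2
    simp [Matrix.mul_fin_two, -Matrix.cons_mul] at e00 e01
    have hb : b = 1 := e01
    have hu : u = -1 := Units.ext (by simpa using e00)
    rw [hb, hu, map_one, h.D_neg_one, one_mul]

include hN in
theorem mem_closure_elementarySet (p : PSL(2, R)) :
    p ∈ Subgroup.closure (elementarySet (R := R) pslT pslD pslS) := by
  have memT (b : R) : pslMk (slT b) ∈ Subgroup.closure (elementarySet (R := R) pslT pslD pslS) :=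
    Subgroup.subset_closure (.inl (.inl ⟨.ofAdd b, rfl⟩))
  have memD (u : Rˣ) : pslMk (slD u) ∈ Subgroup.closure (elementarySet (R := R) pslT pslD pslS) :=
    Subgroup.subset_closure (.inl (.inr ⟨u, rfl⟩))
  have memS : pslMk slS ∈ Subgroup.closure (elementarySet (R := R) pslT pslD pslS) :=
    Subgroup.subset_closure (.inr rfl)
  obtain ⟨M, rfl⟩ := pslMk_surjective p
  induction hn : N (M.1 1 0) using Nat.strong_induction_on generalizing M with
  | _ n IH =>
    by_cases hc : M.1 1 0 = 0
    · have hdet : M.1 0 0 * M.1 1 1 = 1 := by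
        have := M.2
        rw [Matrix.det_fin_two, hc] at this
        simpa using this
      let u : Rˣ := ⟨M.1 0 0, M.1 1 1, hdet, by rw [mul_comm]; exact hdet⟩
      have : M = slT (M.1 0 1 * M.1 0 0) * slD u := by
        ext i j
        fin_cases i <;> fin_cases j <;>
          simp [Matrix.mul_apply, Fin.sum_univ_two, u, hc, mul_assoc, hdet]
      rw [this, map_mul]
      exact mul_mem (memT _) (memD _)
    · obtain ⟨q, hq⟩ := hN.exists_quot (M.1 0 0) hc
      -- The last factor has lower left entry `a - qc`, of smaller norm than `c`.
      have e : pslMk M = pslMk (slT q) * pslMk slS * pslMk (slS * slT (-q) * M) := by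
        rw [← map_mul, ← map_mul, ← pslMk_neg]
        congr 1
        ext i j
        fin_cases i <;> fin_cases j <;>
          simp [Matrix.mul_apply, Fin.sum_univ_two, Matrix.vecMul, dotProduct]
      rw [e]
      refine mul_mem (mul_mem (memT _) memS) (IH _ ?_ _ rfl)
      rw [← hn]
      convert hq using 2
      simp [Matrix.mul_apply, Fin.sum_univ_two]
      ring

include hN h in
/-- Elements of a group that satisfy the relations of translations, diagonal matrices and the
Weyl element define a homomorphism from `PSL₂`. -/
theorem exists_hom_psl [IsDomain R] :
    ∃ Φ : PSL(2, R) →* W, (∀ b, Φ (pslT b) = T b) ∧ (∀ u, Φ (pslD u) = D u) ∧ Φ pslS = s := by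
  have hp : ElementaryRelations (pslT.prod T) (pslD.prod D) ((pslS : PSL(2, R)), s) := by
    have h0 := elementaryRelations_psl (R := R)
    refine ⟨?_, ?_, fun u b => ?_, fun u => ?_, fun u => ?_⟩
    · exact Prod.ext h0.s_mul_s h.s_mul_s
    · exact Prod.ext h0.D_neg_one h.D_neg_one
    · exact Prod.ext (h0.D_mul_T u b) (h.D_mul_T u b)
    · exact Prod.ext (h0.D_mul_s u) (h.D_mul_s u)
    · exact Prod.ext (h0.s_T_s u) (h.s_T_s u)
  -- `P` is the graph of the desired homomorphism: projection to `PSL₂(R)` is injective by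
  -- `eq_one_of_map_eq_one`, applied in the product group, and surjective since elementary matrices
  -- generate.
  let P := Subgroup.closure (elementarySet (pslT.prod T) (pslD.prod D) ((pslS : PSL(2, R)), s))
  have memT (b) : (pslT b, T b) ∈ P := Subgroup.subset_closure (.inl (.inl ⟨b, rfl⟩))
  have memD (u) : (pslD u, D u) ∈ P := Subgroup.subset_closure (.inl (.inr ⟨u, rfl⟩))
  have memS : (pslS, s) ∈ P := Subgroup.subset_closure (.inr rfl)
  let π : P →* PSL(2, R) := (MonoidHom.fst _ _).comp P.subtype
  have hinj : Function.Injective π := by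
    rw [injective_iff_map_eq_one]
    rintro ⟨x, hx⟩ hx1
    exact Subtype.ext (eq_one_of_map_eq_one hN hp (φ := MonoidHom.fst _ _) (fun _ => rfl)
      (fun _ => rfl) rfl hx hx1)
  have hsurj : Function.Surjective π := by
    rw [← MonoidHom.range_eq_top, eq_top_iff]
    rintro p -
    refine (Subgroup.closure_le _).2 ?_ (mem_closure_elementarySet hN p)
    rintro x ((⟨b, rfl⟩ | ⟨u, rfl⟩) | rfl)
    · exact ⟨⟨_, memT b⟩, rfl⟩
    · exact ⟨⟨_, memD u⟩, rfl⟩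
    · exact ⟨⟨_, memS⟩, rfl⟩
  let e := MulEquiv.ofBijective π ⟨hinj, hsurj⟩
  have he (x : P) : e.symm x.1.1 = x := e.symm_apply_apply x
  refine ⟨((MonoidHom.snd _ _).comp P.subtype).comp e.symm.toMonoidHom, fun b => ?_,
    fun u => ?_, ?_⟩
  · exact congrArg (fun y : P => y.1.2) (he ⟨_, memT b⟩)
  · exact congrArg (fun y : P => y.1.2) (he ⟨_, memD u⟩)
  · exact congrArg (fun y : P => y.1.2) (he ⟨_, memS⟩)

include hN in
theorem psl_hom_ext {f g : PSL(2, R) →* W} (hT : ∀ b, f (pslT b) = g (pslT b))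
    (hD : ∀ u, f (pslD u) = g (pslD u)) (hS : f pslS = g pslS) : f = g := by
  refine MonoidHom.ext fun p => ?_
  have : Set.EqOn f g (elementarySet (R := R) pslT pslD pslS) := by
    rintro x ((⟨b, rfl⟩ | ⟨u, rfl⟩) | rfl)
    · exact hT b
    · exact hD u
    · exact hS
  exact MonoidHom.eqOn_closure this (mem_closure_elementarySet hN p)

end Cusp

/-! ### Division with unit steps in `ℤ` and in the Eisenstein integers. -/

theorem isUnitEuclidean_int : IsUnitEuclidean ℤ Int.natAbs where
  zero_lt h := Int.natAbs_pos.2 h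
  map_zero := rfl
  unit_mul u x := by rcases Int.units_eq_one_or u with rfl | rfl <;> simp
  exists_quot a c hc := by
    refine ⟨a / c, ?_⟩
    have h1 := Int.emod_nonneg a hc
    have h2 := Int.emod_lt_abs a hc
    have h3 : a - a / c * c = a % c := by
      have := Int.emod_add_ediv_mul a c
      linarith
    rw [h3]
    rw [Int.abs_eq_natAbs] at h2
    omega
  connected {a c q q'} h h' hne := by
    left
    have h1 : |q' - q| * |c| < 2 * |c| := by
      rw [← abs_mul]
      have e : (q' - q) * c = (a - q * c) - (a - q' * c) := by ring
      rw [e]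
      refine (abs_sub _ _).trans_lt ?_
      simp only [Int.abs_eq_natAbs]
      omega
    have h2 : |q' - q| < 2 := lt_of_mul_lt_mul_right h1 (abs_nonneg c)
    have h3 : q' = q + 1 ∨ q' = q - 1 := by
      rw [abs_lt] at h2
      omega
    rcases h3 with rfl | rfl
    · exact ⟨1, by simp⟩
    · exact ⟨-1, by simp [sub_eq_add_neg]⟩
  exists_unit {a c} hc h := by
    rcases Int.natAbs_eq_natAbs_iff.1 h with rfl | rfl
    · exact ⟨1, by simpa using hc⟩
    · exact ⟨-1, by simpa using hc⟩

/-- The ring of Eisenstein integers `ℤ[ω]`, with `ω² = ω - 1`. -/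
abbrev Eis : Type := QuadraticAlgebra ℤ (-1) 1

namespace Eis

/-- The norm form of the Eisenstein integers. -/
def nrm (x : Eis) : ℤ := x.re ^ 2 + x.re * x.im + x.im ^ 2

theorem nrm_mul (x y : Eis) : nrm (x * y) = nrm x * nrm y := by
  simp only [nrm, QuadraticAlgebra.re_mul, QuadraticAlgebra.im_mul]
  ring

theorem four_mul_nrm (x : Eis) : 4 * nrm x = (2 * x.re + x.im) ^ 2 + 3 * x.im ^ 2 := by
  rw [nrm]
  ring

theorem nrm_nonneg (x : Eis) : 0 ≤ nrm x := by
  have := four_mul_nrm x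
  nlinarith [sq_nonneg (2 * x.re + x.im), sq_nonneg x.im]

theorem nrm_eq_zero {x : Eis} : nrm x = 0 ↔ x = 0 := by
  constructor
  · intro h
    have h1 := four_mul_nrm x
    rw [h] at h1
    have h2 : x.im = 0 := by nlinarith [sq_nonneg (2 * x.re + x.im), sq_nonneg x.im]
    have h3 : x.re = 0 := by
      rw [h2] at h1
      nlinarith [sq_nonneg x.re]
    exact QuadraticAlgebra.ext h3 h2
  · rintro rfl
    rfl

theorem nrm_pos {x : Eis} (hx : x ≠ 0) : 0 < nrm x :=
  lt_of_le_of_ne (nrm_nonneg x) fun h => hx (nrm_eq_zero.1 h.symm)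

instance : IsDomain Eis := by
  have : NoZeroDivisors Eis := ⟨fun {a b} h => by
    have := congrArg nrm h
    rw [nrm_mul, nrm_eq_zero.2 rfl, mul_eq_zero, nrm_eq_zero, nrm_eq_zero] at this
    exact this⟩
  exact NoZeroDivisors.to_isDomain _

theorem nrm_parallelogram (x y : Eis) : nrm (x + y) + nrm (x - y) = 2 * nrm x + 2 * nrm y := by
  simp only [nrm, QuadraticAlgebra.re_add, QuadraticAlgebra.im_add, QuadraticAlgebra.re_sub,
    QuadraticAlgebra.im_sub]
  ring

/-- An element of norm one, as a unit. -/
def unitOfNrm (x : Eis) (hx : nrm x = 1) : Eisˣ where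
  val := x
  inv := ⟨x.re + x.im, -x.im⟩
  val_inv := by
    rw [nrm] at hx
    ext
    · simp only [QuadraticAlgebra.re_mul, QuadraticAlgebra.re_one]
      linarith
    · simp only [QuadraticAlgebra.im_mul, QuadraticAlgebra.im_one]
      ring
  inv_val := by
    rw [nrm] at hx
    ext
    · simp only [QuadraticAlgebra.re_mul, QuadraticAlgebra.re_one]
      linarith
    · simp only [QuadraticAlgebra.im_mul, QuadraticAlgebra.im_one]
      ring

theorem nrm_unit (u : Eisˣ) : nrm u = 1 := by
  have h : nrm u * nrm (u⁻¹ : Eisˣ) = 1 := by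
    rw [← nrm_mul, u.mul_inv]
    rfl
  exact Int.eq_one_of_mul_eq_one_right (nrm_nonneg _) h

theorem abs_le_of_nrm_le {x : Eis} (h : nrm x ≤ 3) :
    x.re ∈ Finset.Icc (-2) 2 ∧ x.im ∈ Finset.Icc (-2) 2 := by
  rw [nrm] at h
  simp only [Finset.mem_Icc]
  refine ⟨⟨?_, ?_⟩, ?_, ?_⟩ <;> nlinarith [sq_nonneg (2 * x.re + x.im), sq_nonneg (2 * x.im + x.re)]

/-- No element has norm 2. An element of norm 3 is the long diagonal of a rhombus of two unit
triangles, whose short diagonal `u - u'` is again a unit; this rhombus supplies the intermediate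
quotient. The norm bound leaves finitely many elements to check. -/
theorem exists_unit_add_unit {x : Eis} (h0 : x ≠ 0) (h : nrm x ≤ 3) :
    nrm x = 1 ∨ nrm x = 3 ∧ ∃ u u' : Eis, nrm u = 1 ∧ nrm u' = 1 ∧ nrm (u - u') = 1 ∧
      x = u + u' := by
  have key : ∀ a ∈ Finset.Icc (-2 : ℤ) 2, ∀ b ∈ Finset.Icc (-2 : ℤ) 2,
      (⟨a, b⟩ : Eis) ≠ 0 → nrm ⟨a, b⟩ ≤ 3 → nrm ⟨a, b⟩ = 1 ∨ nrm ⟨a, b⟩ = 3 ∧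
      ∃ c ∈ Finset.Icc (-1 : ℤ) 1, ∃ d ∈ Finset.Icc (-1 : ℤ) 1, nrm ⟨c, d⟩ = 1 ∧
        nrm (⟨a, b⟩ - ⟨c, d⟩) = 1 ∧ nrm (⟨c, d⟩ - (⟨a, b⟩ - ⟨c, d⟩)) = 1 := by
    unfold nrm
    decide
  obtain ⟨h1, h2⟩ := abs_le_of_nrm_le h
  rcases key _ h1 _ h2 h0 h with h3 | ⟨h3, c, -, d, -, h4, h5, h6⟩
  · exact .inl h3
  · exact .inr ⟨h3, ⟨c, d⟩, _, h4, h5, h6, (add_sub_cancel _ _).symm⟩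

theorem isUnitEuclidean : IsUnitEuclidean Eis fun x => (nrm x).natAbs where
  zero_lt h := Int.natAbs_pos.2 (nrm_pos h).ne'
  map_zero := rfl
  unit_mul u x := by rw [nrm_mul, nrm_unit, one_mul]
  exists_quot a c hc := by
    have hn := nrm_pos hc
    set n := nrm c with hn'
    -- `z` is `a` times the conjugate of `c`, so `a / c = z / n`. Rounding both coordinates leaves
    -- errors of at most `1/2`, hence a remainder of norm at most `3n/4`.
    let z : Eis := a * ⟨c.re + c.im, -c.im⟩
    have round (x : ℤ) : ∃ q, |2 * (x - q * n)| ≤ n := by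
      refine ⟨(2 * x + n) / (2 * n), ?_⟩
      have h1 := Int.emod_nonneg (2 * x + n) (b := 2 * n) (by omega)
      have h2 := Int.emod_lt_of_pos (2 * x + n) (b := 2 * n) (by omega)
      have h3 := Int.emod_add_ediv_mul (2 * x + n) (2 * n)
      rw [abs_le]
      constructor <;> linarith
    obtain ⟨q₁, h₁⟩ := round z.re
    obtain ⟨q₂, h₂⟩ := round z.im
    refine ⟨⟨q₁, q₂⟩, ?_⟩
    have e : nrm (a - ⟨q₁, q₂⟩ * c) * n =
        (z.re - q₁ * n) ^ 2 + (z.re - q₁ * n) * (z.im - q₂ * n) + (z.im - q₂ * n) ^ 2 := by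
      simp only [hn', z, nrm, QuadraticAlgebra.re_mul, QuadraticAlgebra.im_mul,
        QuadraticAlgebra.re_sub, QuadraticAlgebra.im_sub]
      ring
    set x := z.re - q₁ * n
    set y := z.im - q₂ * n
    have hx : (2 * x) ^ 2 ≤ n ^ 2 := sq_le_sq' (abs_le.1 h₁).1 (abs_le.1 h₁).2
    have hy : (2 * y) ^ 2 ≤ n ^ 2 := sq_le_sq' (abs_le.1 h₂).1 (abs_le.1 h₂).2
    have : nrm (a - ⟨q₁, q₂⟩ * c) * n < n * n := by
      rw [e]
      nlinarith [sq_nonneg (x - y)]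
    have := lt_of_mul_lt_mul_right this hn.le
    have := nrm_nonneg (a - ⟨q₁, q₂⟩ * c)
    omega
  connected {a c q q'} h h' hne := by
    have hr0 := nrm_nonneg (a - q * c)
    have hr0' := nrm_nonneg (a - q' * c)
    have hc0 := nrm_nonneg c
    have hr : nrm (a - q * c) < nrm c := by omega
    have hr' : nrm (a - q' * c) < nrm c := by omega
    have e : (a - q * c) - (a - q' * c) = (q' - q) * c := by ring
    have h1 := nrm_parallelogram (a - q * c) (a - q' * c)
    have h2 := nrm_nonneg ((a - q * c) + (a - q' * c))
    rw [e, nrm_mul] at h1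
    -- The two remainders have norm below that of `c`, so by the parallelogram law their difference
    -- `(q' - q)c` has norm below four times it.
    have h3 : nrm (q' - q) ≤ 3 := by
      have : nrm (q' - q) * nrm c < 4 * nrm c := by linarith
      have := lt_of_mul_lt_mul_right this hc0
      omega
    rcases exists_unit_add_unit (sub_ne_zero.2 hne) h3 with h4 | ⟨h4, u, u', hu, hu', huu, hq⟩
    · exact .inl ⟨unitOfNrm _ h4, (add_sub_cancel q q').symm⟩
    · refine .inr ⟨unitOfNrm u hu, unitOfNrm u' hu', ?_, ?_⟩
      · show q' = q + u + u'
        rw [add_assoc, ← hq, add_sub_cancel]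
      · show (nrm (a - (q + u) * c)).natAbs < (nrm c).natAbs
        -- Both diagonals of the rhombus have the same midpoint. The first parallelogram law makes
        -- the sum of the remainders at `q` and `q'` shorter than `c`; the second then bounds the
        -- sum of the norms at `q + u` and `q + u'` by less than the norm of `c`.
        have h5 := nrm_parallelogram (a - (q + u) * c) (a - (q + u') * c)
        have e1 : (a - (q + u) * c) + (a - (q + u') * c) = (a - q * c) + (a - q' * c) := by
          have : q' = q + (u + u') := by rw [← hq, add_sub_cancel]
          rw [this]
          ring
        have e2 : (a - (q + u) * c) - (a - (q + u') * c) = - 1 * (u - u') * c := by ring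
        have e3 : nrm (-1) = 1 := rfl
        rw [e1, e2, nrm_mul, nrm_mul, huu, e3] at h5
        have h6 := nrm_nonneg (a - (q + u) * c)
        have h7 := nrm_nonneg (a - (q + u') * c)
        rw [h4] at h1
        omega
  exists_unit {a c} hc h := by
    have hn := nrm_pos hc
    have ha := nrm_nonneg a
    have hac : nrm a = nrm c := by omega
    by_contra! hcon
    have key (u : Eis) (hu : nrm u = 1) : nrm c ≤ nrm (a - u * c) := by
      have h1 : (nrm c).natAbs ≤ (nrm (a - u * c)).natAbs := hcon (unitOfNrm u hu)
      have := nrm_nonneg (a - u * c)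
      omega
    have k1 := key ⟨1, 0⟩ rfl
    have k2 := key ⟨-1, 0⟩ rfl
    have k3 := key ⟨0, 1⟩ rfl
    have k4 := key ⟨0, -1⟩ rfl
    have k5 := key ⟨-1, 1⟩ rfl
    have k6 := key ⟨1, -1⟩ rfl
    set n := nrm c with hn'
    -- `p₁` and `p₂` are the polar form of the norm at `(a, c)` and `(a, ωc)`. If no unit worked,
    -- `|p₁|`, `|p₂|` and `|p₁ - p₂|` would all be at most `n`, whereas the sum of their squares is
    -- `6n²`.
    let p₁ := 2 * a.re * c.re + a.re * c.im + a.im * c.re + 2 * a.im * c.im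
    let p₂ := -2 * a.re * c.im + a.re * (c.re + c.im) - a.im * c.im + 2 * a.im * (c.re + c.im)
    have e : p₁ ^ 2 - p₁ * p₂ + p₂ ^ 2 = 3 * nrm a * n := by
      simp only [hn', nrm, p₁, p₂]
      ring
    have f (u : Eis) (hu : nrm u = 1) : nrm (a - u * c) = 2 * n - (u.re * p₁ + u.im * p₂) := by
      have : nrm (a - u * c) = nrm a + nrm u * n - (u.re * p₁ + u.im * p₂) := by
        simp only [hn', nrm, p₁, p₂, QuadraticAlgebra.re_mul, QuadraticAlgebra.im_mul,
          QuadraticAlgebra.re_sub, QuadraticAlgebra.im_sub]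
        ring
      rw [this, hu, hac]
      ring
    rw [f _ rfl] at k1 k2 k3 k4 k5 k6
    simp only [hac] at e
    have b1 : p₁ ^ 2 ≤ n ^ 2 := sq_le_sq' (by linarith) (by linarith)
    have b2 : p₂ ^ 2 ≤ n ^ 2 := sq_le_sq' (by linarith) (by linarith)
    have b3 : (p₁ - p₂) ^ 2 ≤ n ^ 2 := sq_le_sq' (by linarith) (by linarith)
    nlinarith

theorem unit_cases (u : Eisˣ) : (u : Eis) = ⟨1, 0⟩ ∨ (u : Eis) = ⟨-1, 0⟩ ∨ (u : Eis) = ⟨0, 1⟩ ∨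
    (u : Eis) = ⟨0, -1⟩ ∨ (u : Eis) = ⟨-1, 1⟩ ∨ (u : Eis) = ⟨1, -1⟩ := by
  have key : ∀ a ∈ Finset.Icc (-2 : ℤ) 2, ∀ b ∈ Finset.Icc (-2 : ℤ) 2, nrm ⟨a, b⟩ = 1 →
      (⟨a, b⟩ : Eis) = ⟨1, 0⟩ ∨ (⟨a, b⟩ : Eis) = ⟨-1, 0⟩ ∨ (⟨a, b⟩ : Eis) = ⟨0, 1⟩ ∨
      (⟨a, b⟩ : Eis) = ⟨0, -1⟩ ∨ (⟨a, b⟩ : Eis) = ⟨-1, 1⟩ ∨ (⟨a, b⟩ : Eis) = ⟨1, -1⟩ := by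
    unfold nrm
    decide
  have hu := nrm_unit u
  obtain ⟨h1, h2⟩ := abs_le_of_nrm_le (x := u) (by omega)
  exact key _ h1 _ h2 hu

/-- The exponent `k` modulo three of a unit `±ω^k`. -/
def unitLog (u : Eis) : ZMod 3 :=
  if u.im = 0 then 0 else if u.re = 0 then 1 else 2

theorem unitLog_mul (u v : Eisˣ) : unitLog ((u * v : Eisˣ) : Eis) = unitLog u + unitLog v := by
  rw [Units.val_mul]
  rcases unit_cases u with h | h | h | h | h | h <;>
    rcases unit_cases v with h' | h' | h' | h' | h' | h' <;> rw [h, h'] <;> decide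

/-- The homomorphism from units to `ℤ/3` with kernel `±1`. -/
def unitLogHom : Eisˣ →* Multiplicative (ZMod 3) :=
  MonoidHom.mk' (fun u => .ofAdd (unitLog u)) fun u v => by
    rw [unitLog_mul, ofAdd_add]

theorem unit_pow_three (u : Eisˣ) : u ^ 3 = 1 ∨ u ^ 3 = -1 := by
  have : (u : Eis) ^ 3 = 1 ∨ (u : Eis) ^ 3 = -1 := by
    rcases unit_cases u with h | h | h | h | h | h <;> rw [h] <;> decide
  simpa only [Units.ext_iff, Units.val_pow_eq_pow_val, Units.val_one, Units.val_neg] using this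

end Eis

/-! ### Finitely many relations suffice over `ℤ` and `ℤ[ω]`. -/

section

variable {R : Type} [CommRing R] {W : Type} [Group W] {T : Multiplicative R →* W} {D : Rˣ →* W}
  {s : W}

/-- If the cube of every unit is `±1`, then the last elementary relation needs to be checked for
the unit `1` only. -/
theorem ElementaryRelations.of_cube (hR : ∀ u : Rˣ, u ^ 3 = 1 ∨ u ^ 3 = -1) (hs : s * s = 1)
    (hD : D (-1) = 1) (hDT : ∀ (u : Rˣ) (b : R), D u * T (.ofAdd b) = T (.ofAdd (u ^ 2 * b)) * D u)
    (hDs : ∀ u, D u * s = s * D u⁻¹) (h1 : (s * T (.ofAdd 1)) ^ 3 = 1) :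
    ElementaryRelations T D s := by
  refine ⟨hs, hD, hDT, hDs, ?_⟩
  have hs' : s⁻¹ = s := inv_eq_of_mul_eq_one_left hs
  have h1' : s * T (.ofAdd 1) * s = T (.ofAdd (-1)) * s * T (.ofAdd (-1)) := by
    rw [ofAdd_neg, map_inv]
    have : s * T (.ofAdd 1) * s * (T (.ofAdd 1) * s * T (.ofAdd 1)) = 1 := by
      rw [← h1, pow_three]
      simp only [mul_assoc]
    rw [eq_inv_of_mul_eq_one_left this]
    simp only [mul_inv_rev, hs', mul_assoc]
  -- Conjugating the relation for the unit 1 by `D v` gives the one for `v²`; inverting a relation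
  -- changes the sign of its unit. These reach every unit, as `u = ±(u⁻¹)²`.
  have hsq (v : Rˣ) : s * T (.ofAdd ((v ^ 2 : Rˣ) : R)) * s =
      T (.ofAdd (-((v ^ 2)⁻¹ : Rˣ) : R)) * s * D (v ^ 2) * T (.ofAdd (-((v ^ 2)⁻¹ : Rˣ) : R)) := by
    have a1 : T (.ofAdd ((v ^ 2 : Rˣ) : R)) = D v * T (.ofAdd 1) * D v⁻¹ := by
      rw [hDT, map_inv, mul_inv_cancel_right, mul_one, Units.val_pow_eq_pow_val]
    have a2 : D v⁻¹ * T (.ofAdd (-1)) = T (.ofAdd (-((v ^ 2)⁻¹ : Rˣ) : R)) * D v⁻¹ := by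
      rw [hDT]
      simp
    have a3 : T (.ofAdd (-1)) * D v = D v * T (.ofAdd (-((v ^ 2)⁻¹ : Rˣ) : R)) := by
      rw [hDT, mul_neg, ← Units.val_pow_eq_pow_val, Units.mul_inv]
    calc s * T (.ofAdd ((v ^ 2 : Rˣ) : R)) * s
        = (s * D v) * T (.ofAdd 1) * (D v⁻¹ * s) := by rw [a1]; simp only [mul_assoc]
      _ = D v⁻¹ * (s * T (.ofAdd 1) * s) * D v := by
          have : s * D v = D v⁻¹ * s := by rw [hDs, inv_inv]
          have h' : D v⁻¹ * s = s * D v := by rw [hDs, inv_inv]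
          rw [h']
          simp only [← mul_assoc]
          rw [this]
      _ = (D v⁻¹ * T (.ofAdd (-1))) * s * (T (.ofAdd (-1)) * D v) := by
          rw [h1']
          simp only [mul_assoc]
      _ = _ := by
          rw [a2, a3, pow_two, D.map_mul]
          have : D v⁻¹ * s = s * D v := by rw [hDs, inv_inv]
          rw [mul_assoc _ _ s, this]
          simp only [mul_assoc]
  have hneg {v : Rˣ} (hv : s * T (.ofAdd (v : R)) * s =
      T (.ofAdd (-(v⁻¹ : Rˣ) : R)) * s * D v * T (.ofAdd (-(v⁻¹ : Rˣ) : R))) :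
      s * T (.ofAdd ((-v : Rˣ) : R)) * s =
      T (.ofAdd (-((-v)⁻¹ : Rˣ) : R)) * s * D (-v) * T (.ofAdd (-((-v)⁻¹ : Rˣ) : R)) := by
    have e : D (-v) = D v := by rw [← neg_one_mul, D.map_mul, hD, one_mul]
    have := congrArg (·⁻¹) hv
    simp only [mul_inv_rev, hs', ← map_inv, ← ofAdd_neg, neg_neg] at this
    rw [e, inv_neg, Units.val_neg, Units.val_neg, neg_neg]
    rw [mul_assoc _ s, ← inv_inv v, ← hDs, inv_inv]
    simpa only [mul_assoc] using this
  intro u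
  rcases hR u⁻¹ with h | h
  · have e : u = u⁻¹ ^ 2 :=
      calc u = u * u⁻¹ ^ 3 := by rw [h, mul_one]
        _ = u⁻¹ ^ 2 := by group
    exact e ▸ hsq u⁻¹
  · have e : u = -(u⁻¹ ^ 2) :=
      calc u = -(u * u⁻¹ ^ 3) := by rw [h, mul_neg, mul_one, neg_neg]
        _ = -(u⁻¹ ^ 2) := by
          congr 1
          group
    exact e ▸ hneg (hsq u⁻¹)

theorem elementaryRelations_int {D : ℤˣ →* W} {T : Multiplicative ℤ →* W} (hs : s * s = 1)
    (hD : D = 1) (h1 : (s * T (.ofAdd 1)) ^ 3 = 1) : ElementaryRelations T D s := by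
  subst hD
  refine .of_cube (fun u => ?_) hs rfl (fun u b => ?_) (fun u => by simp) h1
  · rcases Int.units_eq_one_or u with rfl | rfl
    · exact .inl (one_pow 3)
    · exact .inr rfl
  · rcases Int.units_eq_one_or u with rfl | rfl <;> simp

end

namespace Eis

variable {W : Type} [Group W] {t u l s : W}

/-- The homomorphism from the additive group of Eisenstein integers given by two commuting
elements. -/
def translationHom (htu : Commute t u) : Multiplicative Eis →* W :=
  MonoidHom.mk' (fun b => t ^ b.toAdd.re * u ^ b.toAdd.im) fun a b => by
    rw [toAdd_mul, QuadraticAlgebra.re_add, QuadraticAlgebra.im_add, zpow_add, zpow_add,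
      mul_assoc, mul_assoc, ← mul_assoc (t ^ b.toAdd.re),
      ((htu.zpow_zpow b.toAdd.re a.toAdd.im)).eq, mul_assoc]

theorem translationHom_apply (htu : Commute t u) (a b : ℤ) :
    translationHom htu (.ofAdd ⟨a, b⟩) = t ^ a * u ^ b := rfl

/-- A finite set of relations that implies the elementary relations over the Eisenstein
integers. -/
theorem elementaryRelations (htu : Commute t u) (hl : l ^ 3 = 1) (hlt : l * t = u * t⁻¹ * l)
    (hlu : l * u = t⁻¹ * l) (hs : s * s = 1) (hls : l * s = s * l⁻¹) (hst : (s * t) ^ 3 = 1) :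
    ElementaryRelations (translationHom htu) ((zmod3Hom l hl).comp unitLogHom) s := by
  have hD (v : Eisˣ) : zmod3Hom l hl (unitLogHom v) = l ^ (unitLog v).val := by
    have key : ∀ x : ZMod 3, Multiplicative.ofAdd x = Multiplicative.ofAdd 1 ^ x.val := by decide
    show zmod3Hom l hl (.ofAdd (unitLog v)) = _
    rw [key, map_pow, zmod3Hom_ofAdd_one]
  have hT (b : Eis) : l * translationHom htu (.ofAdd b) =
      translationHom htu (.ofAdd ((⟨-1, 1⟩ : Eis) * b)) * l := by
    have h1 : l * t ^ b.re = (u * t⁻¹) ^ b.re * l := SemiconjBy.zpow_right hlt b.re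
    have h2 : l * u ^ b.im = (t⁻¹) ^ b.im * l := SemiconjBy.zpow_right hlu b.im
    -- `⟨-1, 1⟩` is `ω²`: conjugation by the diagonal matrix of `ω` scales translations by `ω²`,
    -- taking `1` to `ω - 1` and `ω` to `-1`.
    have e : ((⟨-1, 1⟩ : Eis) * b) = ⟨-b.re - b.im, b.re⟩ := by
      ext <;> simp
      ring
    have hut : Commute u t⁻¹ := htu.symm.inv_right
    rw [e, translationHom_apply]
    show l * (t ^ b.re * u ^ b.im) = _
    rw [← mul_assoc, h1, mul_assoc, h2, hut.mul_zpow, ← mul_assoc]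
    congr 1
    rw [inv_zpow', inv_zpow', mul_assoc, ← zpow_add, ← sub_eq_add_neg]
    exact (htu.symm.zpow_zpow _ _).eq
  have hTk (k : ℕ) (b : Eis) : l ^ k * translationHom htu (.ofAdd b) =
      translationHom htu (.ofAdd ((⟨-1, 1⟩ : Eis) ^ k * b)) * l ^ k := by
    induction k with
    | zero => simp
    | succ k ih => rw [pow_succ', mul_assoc, ih, ← mul_assoc, hT, mul_assoc, pow_succ', mul_assoc]
  have hv2 (v : Eisˣ) : (v : Eis) ^ 2 = (⟨-1, 1⟩ : Eis) ^ (unitLog v).val := by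
    rcases unit_cases v with h | h | h | h | h | h <;> rw [h] <;> decide
  refine .of_cube unit_pow_three hs ?_ (fun v b => ?_) (fun v => ?_) ?_
  · show zmod3Hom l hl (unitLogHom (-1)) = 1
    rw [hD]
    exact pow_zero l
  · show zmod3Hom l hl (unitLogHom v) * _ = _ * zmod3Hom l hl (unitLogHom v)
    rw [hD, hTk, hv2]
  · rw [map_inv]
    show zmod3Hom l hl (unitLogHom v) * s = s * (zmod3Hom l hl (unitLogHom v))⁻¹
    rw [hD, ← inv_pow]
    exact (SemiconjBy.pow_right (show SemiconjBy s l⁻¹ l from hls.symm) _).symm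
  · show (s * (t ^ (1 : ℤ) * u ^ (0 : ℤ))) ^ 3 = 1
    simpa using hst

end Eis

/-! ### The induced permutation action on ten copies of `G`. -/

/-- The permutation of `ι × G` that permutes the first factor by `π` and multiplies the second
factor by a cocycle. -/
def cocyclePerm {ι G : Type} [Group G] (π : Equiv.Perm ι) (c : ι → G) : Equiv.Perm (ι × G) :=
  π.prodShear fun x => Equiv.mulLeft (c x)

theorem cocyclePerm_apply {ι G : Type} [Group G] (π : Equiv.Perm ι) (c : ι → G) (x : ι) (g : G) :
    cocyclePerm π c (x, g) = (π x, c x * g) := rfl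

theorem cocyclePerm_mul {ι G : Type} [Group G] (π π' : Equiv.Perm ι) (c c' : ι → G) :
    cocyclePerm π c * cocyclePerm π' c' = cocyclePerm (π * π') fun x => c (π' x) * c' x := by
  ext ⟨x, g⟩ <;> simp [cocyclePerm_apply, mul_assoc]

theorem cocyclePerm_one {ι G : Type} [Group G] :
    cocyclePerm (1 : Equiv.Perm ι) (fun _ => (1 : G)) = 1 := by
  ext ⟨x, g⟩ <;> simp [cocyclePerm_apply]

/-- The relations of the HNN-extension of `S₃ ∗ D(3,3,3)` in terms of an involution `S` and an
element `Y` of order three of `S₃`, the generators `X` and `Y` of `D(3,3,3)`, and the stable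
letter `w`. -/
structure HNNRelations {G : Type} [Group G] (S X Y w : G) : Prop where
  S_mul_S : S * S = 1
  X_pow : X ^ 3 = 1
  Y_pow : Y ^ 3 = 1
  Y_mul_S : Y * S = S * Y⁻¹
  XY_pow : (X * Y) ^ 3 = 1
  w_mul_S : w * S = S * Y * w
  w_mul_X : w * X = X * Y * w

namespace HNNRelations

variable {G : Type} [Group G] {S X Y w : G} (h : HNNRelations S X Y w)

/-- The action of the translation by `1` on the cosets. -/
def permT : Equiv.Perm (Fin 10) :=
  ⟨![0, 1, 3, 2, 5, 4, 7, 6, 9, 8], ![0, 1, 3, 2, 5, 4, 7, 6, 9, 8], by decide, by decide⟩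

/-- The action of the translation by `ω` on the cosets. -/
def permU : Equiv.Perm (Fin 10) :=
  ⟨![1, 0, 3, 2, 4, 5, 8, 9, 6, 7], ![1, 0, 3, 2, 4, 5, 8, 9, 6, 7], by decide, by decide⟩

/-- The action of the diagonal matrix with entry `ω` on the cosets. -/
def permL : Equiv.Perm (Fin 10) :=
  ⟨![2, 3, 4, 5, 0, 1, 6, 9, 7, 8], ![4, 5, 0, 1, 2, 3, 6, 8, 9, 7], by decide, by decide⟩

/-- The action of the Weyl element on the cosets. -/
def permS : Equiv.Perm (Fin 10) :=
  ⟨![0, 7, 4, 8, 2, 9, 6, 1, 3, 5], ![0, 7, 4, 8, 2, 9, 6, 1, 3, 5], by decide, by decide⟩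

include h

theorem S_mul_S_mul (a : G) : S * (S * a) = a := by
  rw [← mul_assoc, h.S_mul_S, one_mul]

theorem X_mul_X : X * X = X⁻¹ := by
  rw [eq_inv_iff_mul_eq_one, ← h.X_pow, pow_succ, pow_two]

theorem Y_mul_Y : Y * Y = Y⁻¹ := by
  rw [eq_inv_iff_mul_eq_one, ← h.Y_pow, pow_succ, pow_two]

theorem Y_mul_X_mul_Y : Y * (X * Y) = X⁻¹ * (Y⁻¹ * X⁻¹) := by
  have := h.XY_pow
  rw [pow_three] at this
  have h1 : X * (Y * (X * Y)) * (X * Y) = 1 := by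
    rw [← this]
    simp only [mul_assoc]
  rw [← eq_inv_iff_mul_eq_one, mul_inv_rev] at h1
  rw [eq_inv_mul_iff_mul_eq, h1]

theorem w_mul_X_inv : w * X⁻¹ = Y⁻¹ * (X⁻¹ * w) := by
  have : X * Y * (w * X⁻¹) = w := by rw [← mul_assoc, ← h.w_mul_X, mul_inv_cancel_right]
  rw [← mul_assoc, ← mul_inv_rev, eq_inv_mul_iff_mul_eq, this]

theorem S_mul_w_inv : S * w⁻¹ = w⁻¹ * (S * Y) := by
  rw [eq_inv_mul_iff_mul_eq, ← mul_assoc, h.w_mul_S, mul_inv_cancel_right]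

theorem X_mul_w_inv : X * w⁻¹ = w⁻¹ * (X * Y) := by
  rw [eq_inv_mul_iff_mul_eq, ← mul_assoc, h.w_mul_X, mul_inv_cancel_right]

theorem X_inv_mul_w_inv : X⁻¹ * w⁻¹ = w⁻¹ * (Y⁻¹ * X⁻¹) := by
  rw [eq_inv_mul_iff_mul_eq, ← mul_assoc, h.w_mul_X_inv, ← mul_assoc, mul_inv_cancel_right]

theorem Y_inv_mul_S : Y⁻¹ * S = S * Y := by
  rw [inv_mul_eq_iff_eq_mul, ← mul_assoc, h.Y_mul_S, inv_mul_cancel_right]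

theorem X_mul_X_mul (a : G) : X * (X * a) = X⁻¹ * a := by
  simpa only [mul_assoc] using congrArg (· * a) h.X_mul_X

theorem Y_mul_Y_mul (a : G) : Y * (Y * a) = Y⁻¹ * a := by
  simpa only [mul_assoc] using congrArg (· * a) h.Y_mul_Y

theorem X_inv_mul_X_inv : X⁻¹ * X⁻¹ = X := by
  rw [← mul_inv_rev, h.X_mul_X, inv_inv]

theorem Y_inv_mul_Y_inv : Y⁻¹ * Y⁻¹ = Y := by
  rw [← mul_inv_rev, h.Y_mul_Y, inv_inv]

theorem Y_inv_mul_X_inv_mul_Y_inv : Y⁻¹ * (X⁻¹ * Y⁻¹) = X * (Y * X) := by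
  simpa [mul_assoc] using congrArg (·⁻¹) h.Y_mul_X_mul_Y

theorem X_inv_mul_X_inv_mul (a : G) : X⁻¹ * (X⁻¹ * a) = X * a := by
  simpa only [mul_assoc] using congrArg (· * a) h.X_inv_mul_X_inv

theorem Y_mul_S_mul (a : G) : Y * (S * a) = S * (Y⁻¹ * a) := by
  simpa only [mul_assoc] using congrArg (· * a) h.Y_mul_S

theorem Y_inv_mul_S_mul (a : G) : Y⁻¹ * (S * a) = S * (Y * a) := by
  simpa only [mul_assoc] using congrArg (· * a) h.Y_inv_mul_S

theorem w_mul_S_mul (a : G) : w * (S * a) = S * (Y * (w * a)) := by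
  simpa only [mul_assoc] using congrArg (· * a) h.w_mul_S

theorem w_mul_X_mul (a : G) : w * (X * a) = X * (Y * (w * a)) := by
  simpa only [mul_assoc] using congrArg (· * a) h.w_mul_X

theorem S_mul_w_inv_mul (a : G) : S * (w⁻¹ * a) = w⁻¹ * (S * (Y * a)) := by
  simpa only [mul_assoc] using congrArg (· * a) h.S_mul_w_inv

theorem X_mul_w_inv_mul (a : G) : X * (w⁻¹ * a) = w⁻¹ * (X * (Y * a)) := by
  simpa only [mul_assoc] using congrArg (· * a) h.X_mul_w_inv

theorem Y_mul_X_mul_Y_mul (a : G) : Y * (X * (Y * a)) = X⁻¹ * (Y⁻¹ * (X⁻¹ * a)) := by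
  simpa only [mul_assoc] using congrArg (· * a) h.Y_mul_X_mul_Y

theorem Y_inv_mul_X_inv_mul_Y_inv_mul (a : G) : Y⁻¹ * (X⁻¹ * (Y⁻¹ * a)) = X * (Y * (X * a)) := by
  simpa only [mul_assoc] using congrArg (· * a) h.Y_inv_mul_X_inv_mul_Y_inv

omit h

variable (S X Y w)

/-- The translation by `1`, acting on pairs of a coset and a group element. -/
def indT : Equiv.Perm (Fin 10 × G) := cocyclePerm permT
  ![X * S, X * S, S * X⁻¹ * w⁻¹, 1, S * X⁻¹, w, 1, Y * X⁻¹, Y * X⁻¹, 1]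

/-- The translation by `ω`, acting on pairs of a coset and a group element. -/
def indU : Equiv.Perm (Fin 10 × G) := cocyclePerm permU
  ![1, X * S * w, w⁻¹, X * S, S * X⁻¹, S * X⁻¹, 1, Y * X⁻¹, Y⁻¹ * X, X * Y * X]

/-- The diagonal matrix with entry `ω`, acting on pairs of a coset and a group element. -/
def indL : Equiv.Perm (Fin 10 × G) := cocyclePerm permL
  ![1, 1, 1, 1, 1, 1, Y, Y, X, X⁻¹ * Y⁻¹]

/-- The Weyl element, acting on pairs of a coset and a group element. -/
def indS : Equiv.Perm (Fin 10 × G) := cocyclePerm permS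
  ![S, X * S * w, S, S * w, S, X⁻¹ * w * X⁻¹ * S, S * Y⁻¹, S * X⁻¹ * w⁻¹, w⁻¹ * S,
    S * X * w⁻¹ * X]

variable {S X Y w}

theorem cocyclePerm_congr {π π' : Equiv.Perm (Fin 10)} {c c' : Fin 10 → G} (hπ : π = π')
    (hc : ∀ x, c x = c' x) : cocyclePerm π c = cocyclePerm π' c' := by
  rw [hπ, funext hc]

include h

/-- This and the following identities are the relations needed for `PSL₂(ℤ[ω])`. Each is a relation
of permutations together with ten word identities in `G`, solved by rewriting with consequences of
`HNNRelations`. -/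
theorem indT_mul_indU : indT S X Y w * indU S X Y w = indU S X Y w * indT S X Y w := by
  rw [indT, indU]
  simp only [cocyclePerm_mul]
  refine cocyclePerm_congr (by decide) fun x => ?_
  fin_cases x <;> simp [permT, permU, mul_assoc, h.S_mul_S, h.S_mul_S_mul, h.Y_mul_Y_mul,
    h.X_inv_mul_X_inv, h.Y_mul_S_mul, h.w_mul_S, h.w_mul_S_mul, h.w_mul_X_mul, h.w_mul_X_inv,
    h.S_mul_w_inv_mul, h.X_mul_w_inv_mul, h.X_inv_mul_w_inv, h.Y_mul_X_mul_Y_mul]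

theorem indL_pow : indL X Y ^ 3 = (1 : Equiv.Perm (Fin 10 × G)) := by
  rw [pow_succ, pow_two, indL, ← cocyclePerm_one]
  simp only [cocyclePerm_mul]
  refine cocyclePerm_congr (by decide) fun x => ?_
  fin_cases x <;> simp [permL, mul_assoc, h.Y_mul_Y]

theorem indT_mul_indL_mul_indT :
    indT S X Y w * indL X Y * indT S X Y w = indU S X Y w * indL X Y := by
  rw [indT, indL, indU]
  simp only [cocyclePerm_mul]
  refine cocyclePerm_congr (by decide) fun x => ?_
  fin_cases x <;> simp [permT, permL, mul_assoc, h.S_mul_S, h.S_mul_S_mul, h.Y_mul_Y_mul,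
    h.X_inv_mul_X_inv_mul, h.Y_inv_mul_Y_inv, h.S_mul_w_inv_mul, h.X_inv_mul_w_inv,
    h.Y_mul_X_mul_Y]

theorem indT_mul_indL_mul_indU : indT S X Y w * indL X Y * indU S X Y w = indL X Y := by
  rw [indT, indL, indU]
  simp only [cocyclePerm_mul]
  refine cocyclePerm_congr (by decide) fun x => ?_
  fin_cases x <;> simp [permU, permL, mul_assoc, h.S_mul_S, h.S_mul_S_mul, h.X_inv_mul_X_inv_mul,
    h.S_mul_w_inv_mul, h.X_inv_mul_w_inv, h.Y_mul_X_mul_Y_mul]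

theorem indS_mul_indS : indS S X Y w * indS S X Y w = (1 : Equiv.Perm (Fin 10 × G)) := by
  rw [indS, ← cocyclePerm_one]
  simp only [cocyclePerm_mul]
  refine cocyclePerm_congr (by decide) fun x => ?_
  fin_cases x <;> simp [permS, mul_assoc, h.S_mul_S, h.S_mul_S_mul, h.Y_mul_S_mul,
    h.Y_inv_mul_S_mul, h.w_mul_S, h.w_mul_X_inv, h.S_mul_w_inv_mul, h.X_mul_w_inv,
    h.X_inv_mul_w_inv, h.Y_mul_X_mul_Y, h.Y_inv_mul_X_inv_mul_Y_inv,
    h.Y_inv_mul_X_inv_mul_Y_inv_mul]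

theorem indL_mul_indS_mul_indL : indL X Y * indS S X Y w * indL X Y = indS S X Y w := by
  rw [indL, indS]
  simp only [cocyclePerm_mul]
  refine cocyclePerm_congr (by decide) fun x => ?_
  fin_cases x <;> simp [permL, permS, mul_assoc, h.Y_mul_Y, h.Y_inv_mul_Y_inv, h.Y_mul_S_mul,
    h.w_mul_S, h.w_mul_X_inv, h.S_mul_w_inv_mul, h.X_mul_w_inv, h.X_inv_mul_w_inv,
    h.Y_mul_X_mul_Y, h.Y_inv_mul_X_inv_mul_Y_inv_mul]
  rw [← h.Y_inv_mul_S_mul, h.Y_inv_mul_X_inv_mul_Y_inv_mul, inv_mul_cancel_left]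

theorem indS_mul_indT_pow :
    (indS S X Y w * indT S X Y w) ^ 3 = (1 : Equiv.Perm (Fin 10 × G)) := by
  rw [pow_succ, pow_two, indS, indT, ← cocyclePerm_one]
  simp only [cocyclePerm_mul]
  refine cocyclePerm_congr (by decide) fun x => ?_
  fin_cases x <;> simp [permT, permS, mul_assoc, h.S_mul_S, h.S_mul_S_mul, h.X_mul_X_mul,
    h.X_inv_mul_X_inv, h.Y_mul_S, h.Y_mul_S_mul, h.w_mul_S, h.w_mul_S_mul, h.w_mul_X_mul,
    h.w_mul_X_inv, h.S_mul_w_inv_mul, h.X_mul_w_inv, h.X_inv_mul_w_inv, h.Y_mul_X_mul_Y,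
    h.Y_inv_mul_X_inv_mul_Y_inv_mul]

end HNNRelations

/-! ### Injectivity, image and finite index from the induced action. -/

theorem pslMk_eq_of_eq_or_eq_neg {R : Type} [CommRing R] {A B : SL(2, R)}
    (h : A.1 = B.1 ∨ A.1 = (-B).1) : pslMk A = pslMk B := by
  rcases h with h | h
  · rw [Subtype.ext h]
  · rw [Subtype.ext h, pslMk_neg]

namespace Eis

/-- The diagonal matrix with entry `ω`. -/
def slL : SL(2, Eis) := ⟨!![⟨0, 1⟩, 0; 0, ⟨1, -1⟩], by rw [Matrix.det_fin_two]; rfl⟩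

/-- The image of the generator `y` of `D(3,3,3)`. -/
def slY : SL(2, Eis) := ⟨!![⟨-1, 0⟩, ⟨-1, 2⟩; ⟨-1, 2⟩, ⟨2, 0⟩], by rw [Matrix.det_fin_two]; rfl⟩

/-- The image of the generator `x` of `D(3,3,3)`. -/
def slX : SL(2, Eis) := slT 1 * slS

/-- The image of the stable letter: the translation by `√-3`. -/
def slW : SL(2, Eis) := slT ⟨-1, 2⟩

theorem hnnRelations_psl :
    HNNRelations (pslMk slS) (pslMk slX) (pslMk slY) (pslMk slW) where
  S_mul_S := by
    rw [← map_mul, ← map_one pslMk]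
    exact pslMk_eq_of_eq_or_eq_neg (by decide)
  X_pow := by
    rw [← map_pow, ← map_one pslMk]
    exact pslMk_eq_of_eq_or_eq_neg (by decide)
  Y_pow := by
    rw [← map_pow, ← map_one pslMk]
    exact pslMk_eq_of_eq_or_eq_neg (by decide)
  Y_mul_S := by
    rw [← map_inv, ← map_mul, ← map_mul]
    exact pslMk_eq_of_eq_or_eq_neg (by decide)
  XY_pow := by
    rw [← map_mul, ← map_pow, ← map_one pslMk]
    exact pslMk_eq_of_eq_or_eq_neg (by decide)
  w_mul_S := by
    rw [← map_mul, ← map_mul, ← map_mul]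
    exact pslMk_eq_of_eq_or_eq_neg (by decide)
  w_mul_X := by
    rw [← map_mul, ← map_mul, ← map_mul]
    exact pslMk_eq_of_eq_or_eq_neg (by decide)

/-- Representatives of the cosets of `PSL₂(ℤ[√-3])` in `PSL₂(ℤ[ω])`. -/
def cosetRep : Fin 10 → SL(2, Eis) :=
  let U : SL(2, Eis) := slT ⟨0, 1⟩
  let r : SL(2, Eis) := slT (-1) * slS * slT ⟨0, -1⟩
  ![1, U, slL, slL * U, slL * slL, slL * slL * U, r, slT 1 * r, U * r, slT ⟨-1, 1⟩ * r]

theorem exists_odd_im_cosetRep : ∀ x ≠ 0, ∃ i j, ¬ (2 ∣ ((cosetRep x).1 i j).im) := by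
  decide

theorem pslT_eq (a b : ℤ) :
    (pslT (.ofAdd ⟨a, b⟩) : PSL(2, Eis)) = pslMk (slT 1) ^ a * pslMk (slT ⟨0, 1⟩) ^ b := by
  have h : (Multiplicative.ofAdd ⟨a, b⟩ : Multiplicative Eis) =
      .ofAdd 1 ^ a * .ofAdd ⟨0, 1⟩ ^ b := by
    rw [← ofAdd_zsmul, ← ofAdd_zsmul, ← ofAdd_add]
    congr 1
    ext
    · simp
    · simp
  rw [h, map_mul, map_zpow, map_zpow]
  rfl

/-- The unit `ω`. -/
def omegaUnit : Eisˣ := unitOfNrm ⟨0, 1⟩ (by decide)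

theorem pslD_omegaUnit : pslD omegaUnit = pslMk slL :=
  congrArg pslMk (Subtype.ext (by decide))

theorem unitLogHom_omegaUnit : unitLogHom omegaUnit = .ofAdd 1 := by
  decide

theorem pslD_mem_zpowers (u : Eisˣ) : pslD u ∈ Subgroup.zpowers (pslMk slL) := by
  have hu : ∃ k : ℕ, u = omegaUnit ^ k := by
    rcases unit_cases u with h | h | h | h | h | h
    · exact ⟨0, Units.ext (h.trans (by decide))⟩
    · exact ⟨3, Units.ext (h.trans (by decide))⟩
    · exact ⟨1, Units.ext (h.trans (by decide))⟩
    · exact ⟨4, Units.ext (h.trans (by decide))⟩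
    · exact ⟨2, Units.ext (h.trans (by decide))⟩
    · exact ⟨5, Units.ext (h.trans (by decide))⟩
  obtain ⟨k, rfl⟩ := hu
  rw [map_pow, pslD_omegaUnit]
  exact pow_mem (Subgroup.mem_zpowers _) k

variable {G : Type} [Group G] {S X Y w : G} (h : HNNRelations S X Y w)

include h

/-- The induced action of `PSL₂(ℤ[ω])` on pairs of a coset and an element of a group with the
relations of the HNN-extension. -/
theorem exists_inducedAction : ∃ Φ : PSL(2, Eis) →* Equiv.Perm (Fin 10 × G),
    Φ (pslMk (slT 1)) = HNNRelations.indT S X Y w ∧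
    Φ (pslMk (slT ⟨0, 1⟩)) = HNNRelations.indU S X Y w ∧
    Φ (pslMk slL) = HNNRelations.indL X Y ∧ Φ (pslMk slS) = HNNRelations.indS S X Y w := by
  have hc : Commute _ _ := h.indT_mul_indU
  have e1 := h.indT_mul_indL_mul_indT
  have e2 := h.indT_mul_indL_mul_indU
  have e3 := h.indL_mul_indS_mul_indL
  have hlt : HNNRelations.indL X Y * HNNRelations.indT S X Y w =
      HNNRelations.indU S X Y w * (HNNRelations.indT S X Y w)⁻¹ * HNNRelations.indL X Y := by
    rw [hc.symm.inv_right.eq, mul_assoc, eq_inv_mul_iff_mul_eq, ← mul_assoc, e1]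
  have hlu : HNNRelations.indL X Y * HNNRelations.indU S X Y w =
      (HNNRelations.indT S X Y w)⁻¹ * HNNRelations.indL X Y := by
    rw [eq_inv_mul_iff_mul_eq, ← mul_assoc, e2]
  have hls : HNNRelations.indL X Y * HNNRelations.indS S X Y w =
      HNNRelations.indS S X Y w * (HNNRelations.indL X Y)⁻¹ := by
    rw [eq_mul_inv_iff_mul_eq, e3]
  obtain ⟨Φ, hT, hD, hS⟩ := exists_hom_psl isUnitEuclidean
    (elementaryRelations hc h.indL_pow hlt hlu h.indS_mul_indS hls h.indS_mul_indT_pow)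
  refine ⟨Φ, ?_, ?_, ?_, hS⟩
  · have := hT (.ofAdd ⟨1, 0⟩)
    rw [translationHom_apply, zpow_one, zpow_zero, mul_one] at this
    exact this
  · have := hT (.ofAdd ⟨0, 1⟩)
    rw [translationHom_apply, zpow_one, zpow_zero, one_mul] at this
    exact this
  · rw [← pslD_omegaUnit, hD, MonoidHom.comp_apply, unitLogHom_omegaUnit, zmod3Hom_ofAdd_one]

variable {f : G →* PSL(2, Eis)} (hS : f S = pslMk slS) (hX : f X = pslMk slX)
  (hw : f w = pslMk slW)

include hS hw

/-- `w S w⁻¹ = S Y` makes `Y` a word in `S` and `w`, so its image need not be assumed. -/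
theorem map_Y : f Y = pslMk slY := by
  have e : Y = S * w * S * w⁻¹ := by
    rw [mul_assoc S, h.w_mul_S, ← mul_assoc, mul_inv_cancel_right, ← mul_assoc, h.S_mul_S, one_mul]
  rw [e, map_mul, map_mul, map_mul, map_inv, hS, hw, ← map_mul, ← map_mul, ← map_inv, ← map_mul]
  exact pslMk_eq_of_eq_or_eq_neg (by decide)

include hX

theorem inducedAction_apply_zero {Φ : PSL(2, Eis) →* Equiv.Perm (Fin 10 × G)}
    (hΦT : Φ (pslMk (slT 1)) = HNNRelations.indT S X Y w)
    (hΦU : Φ (pslMk (slT ⟨0, 1⟩)) = HNNRelations.indU S X Y w)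
    (hΦS : Φ (pslMk slS) = HNNRelations.indS S X Y w)
    (hG : Subgroup.closure {S, X, w} = (⊤ : Subgroup G)) (g k : G) :
    Φ (f g) (0, k) = (0, g * k) := by
  have hg : g ∈ Subgroup.closure {S, X, w} := hG ▸ Subgroup.mem_top g
  induction hg using Subgroup.closure_induction generalizing k with
  | mem g hg =>
    have eS (k : G) : HNNRelations.indS S X Y w (0, k) = (0, S * k) := rfl
    have eT (k : G) : HNNRelations.indT S X Y w (0, k) = (0, X * S * k) := rfl
    rcases hg with rfl | rfl | rfl
    · rw [hS, hΦS, eS]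
    · rw [hX, slX, map_mul, map_mul, hΦT, hΦS, Equiv.Perm.mul_apply, eS, eT, ← mul_assoc,
        mul_assoc g, h.S_mul_S, mul_one]
    -- `√-3 = 2ω - 1`; the two translations by `ω` go from coset 0 to coset 1 and back.
    · have e : pslMk slW = (pslMk (slT 1))⁻¹ * pslMk (slT ⟨0, 1⟩) * pslMk (slT ⟨0, 1⟩) := by
        rw [← map_inv, ← map_mul, ← map_mul]
        exact pslMk_eq_of_eq_or_eq_neg (by decide)
      have eU (k : G) : HNNRelations.indU S X Y g (0, k) = (1, 1 * k) := rfl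
      have eU' (k : G) : HNNRelations.indU S X Y g (1, k) = (0, X * S * g * k) := rfl
      rw [hw, e, map_mul, map_mul, map_inv, hΦT, hΦU, Equiv.Perm.mul_apply, Equiv.Perm.mul_apply,
        eU, eU', Equiv.Perm.inv_eq_iff_eq, eT, one_mul]
      simp only [mul_assoc]
  | one => simp
  | mul a b _ _ ha hb => rw [map_mul, map_mul, Equiv.Perm.mul_apply, hb, ha, mul_assoc]
  | inv a _ ha =>
    rw [map_inv, map_inv, Equiv.Perm.inv_eq_iff_eq, ha, mul_inv_cancel_left]

theorem injective_of_hnnRelations (hG : Subgroup.closure {S, X, w} = (⊤ : Subgroup G)) :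
    Function.Injective f := by
  obtain ⟨Φ, hT, hU, -, hΦS⟩ := exists_inducedAction h
  rw [injective_iff_map_eq_one]
  intro g hg
  have := inducedAction_apply_zero h hS hX hw hT hU hΦS hG g 1
  rw [hg, map_one, mul_one] at this
  exact (congrArg Prod.snd this).symm

/-- The map `(x, g) ↦ r_x f(g)` intertwines the induced action with left multiplication: on
generators this is the matrix identity `A r_x = ± r_{π x} c_x`, which is where the tables of
permutations and cocycles come from. Evaluating at `(0, 1)` gives the decomposition. -/
theorem exists_cosetRep_mul (p : PSL(2, Eis)) : ∃ x g, p = pslMk (cosetRep x) * f g := by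
  have hY := map_Y h hS hw
  obtain ⟨Φ, hT, hU, hL, hΦS⟩ := exists_inducedAction h
  let τ (y : Fin 10 × G) : PSL(2, Eis) := pslMk (cosetRep y.1) * f y.2
  let Q : Subgroup PSL(2, Eis) :=
    { carrier := {p | ∀ y, τ (Φ p y) = p * τ y}
      one_mem' := fun y => by simp
      mul_mem' := fun {a b} ha hb y => by
        rw [map_mul, Equiv.Perm.mul_apply, ha, hb, mul_assoc]
      inv_mem' := fun {a} ha y => by
        rw [eq_inv_mul_iff_mul_eq, ← ha, map_inv]
        exact congrArg τ ((Φ a).apply_symm_apply y) }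
  have key {A : SL(2, Eis)} {π : Equiv.Perm (Fin 10)} {c : Fin 10 → G} {C : Fin 10 → SL(2, Eis)}
      (hA : Φ (pslMk A) = cocyclePerm π c) (hc : ∀ x, f (c x) = pslMk (C x))
      (hC : ∀ x, (cosetRep (π x) * C x).1 = (A * cosetRep x).1 ∨
        (cosetRep (π x) * C x).1 = (-(A * cosetRep x)).1) : pslMk A ∈ Q := by
    rintro ⟨x, g⟩
    show τ (Φ (pslMk A) (x, g)) = _
    rw [hA, cocyclePerm_apply]
    show pslMk (cosetRep (π x)) * f (c x * g) = pslMk A * (pslMk (cosetRep x) * f g)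
    rw [map_mul, hc, ← mul_assoc, ← mul_assoc, ← map_mul, ← map_mul,
      pslMk_eq_of_eq_or_eq_neg (hC x)]
  have memT : pslMk (slT 1) ∈ Q := by
    refine key hT (C := ![slX * slS, slX * slS, slS * slX⁻¹ * slW⁻¹, 1, slS * slX⁻¹, slW, 1,
      slY * slX⁻¹, slY * slX⁻¹, 1]) (fun x => ?_) (by decide)
    fin_cases x <;> simp [hS, hX, hY, hw]
  have memU : pslMk (slT ⟨0, 1⟩) ∈ Q := by
    refine key hU (C := ![1, slX * slS * slW, slW⁻¹, slX * slS, slS * slX⁻¹, slS * slX⁻¹, 1,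
      slY * slX⁻¹, slY⁻¹ * slX, slX * slY * slX]) (fun x => ?_) (by decide)
    fin_cases x <;> simp [hS, hX, hY, hw]
  have memL : pslMk slL ∈ Q := by
    refine key hL (C := ![1, 1, 1, 1, 1, 1, slY, slY, slX, slX⁻¹ * slY⁻¹]) (fun x => ?_)
      (by decide)
    fin_cases x <;> simp [hX, hY]
  have memS : pslMk slS ∈ Q := by
    refine key hΦS (C := ![slS, slX * slS * slW, slS, slS * slW, slS, slX⁻¹ * slW * slX⁻¹ * slS,
      slS * slY⁻¹, slS * slX⁻¹ * slW⁻¹, slW⁻¹ * slS, slS * slX * slW⁻¹ * slX]) (fun x => ?_)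
      (by decide)
    fin_cases x <;> simp [hS, hX, hY, hw]
  have hQ : p ∈ Q := by
    refine (Subgroup.closure_le _).2 ?_ (mem_closure_elementarySet isUnitEuclidean p)
    rintro _ ((⟨b, rfl⟩ | ⟨u, rfl⟩) | rfl)
    · have := pslT_eq b.toAdd.re b.toAdd.im
      exact this ▸ mul_mem (zpow_mem memT _) (zpow_mem memU _)
    · exact Subgroup.zpowers_le.2 memL (pslD_mem_zpowers u)
    · exact memS
  refine ⟨(Φ p (0, 1)).1, (Φ p (0, 1)).2, ?_⟩
  have := hQ (0, 1)
  have e : τ (0, 1) = 1 := by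
    show pslMk 1 * f 1 = 1
    simp
  rw [e, mul_one] at this
  exact this.symm

/-- The range of the homomorphism from the HNN-extension consists of the matrices with entries in
`ℤ[√-3]`. -/
theorem range_eq {H : Subgroup PSL(2, Eis)}
    (hH : ∀ A, pslMk A ∈ H ↔ ∀ i j, 2 ∣ (A.1 i j).im)
    (hG : Subgroup.closure {S, X, w} = (⊤ : Subgroup G)) : f.range = H := by
  have hle : f.range ≤ H := by
    rw [MonoidHom.range_eq_map, ← hG, MonoidHom.map_closure, Subgroup.closure_le]
    rintro _ ⟨g, rfl | rfl | rfl, rfl⟩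
    · rw [hS]
      exact (hH _).2 (by decide)
    · rw [hX]
      exact (hH _).2 (by decide)
    · rw [hw]
      exact (hH _).2 (by decide)
  refine le_antisymm hle fun p hp => ?_
  obtain ⟨x, g, rfl⟩ := exists_cosetRep_mul h hS hX hw p
  -- The representative itself lies in `H`, but every nontrivial one has an entry with odd
  -- `ω`-coordinate.
  have hx := (Subgroup.mul_mem_cancel_right H (hle ⟨g, rfl⟩)).1 hp
  rw [hH] at hx
  by_cases hx0 : x = 0
  · rw [hx0]
    refine ⟨g, ?_⟩
    show f g = pslMk 1 * f g
    rw [map_one, one_mul]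
  · obtain ⟨i, j, hij⟩ := exists_odd_im_cosetRep x hx0
    exact absurd (hx i j) hij

theorem finiteIndex_range : f.range.FiniteIndex := by
  have : Function.Surjective fun x : Fin 10 =>
      ((pslMk (cosetRep x) : PSL(2, Eis)) : PSL(2, Eis) ⧸ f.range) := by
    intro q
    obtain ⟨p, rfl⟩ := QuotientGroup.mk_surjective q
    obtain ⟨x, g, rfl⟩ := exists_cosetRep_mul h hS hX hw p
    exact ⟨x, (QuotientGroup.mk_mul_of_mem _ (MonoidHom.mem_range.2 ⟨g, rfl⟩)).symm⟩
  have := Finite.of_surjective _ this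
  exact Subgroup.finiteIndex_of_finite_quotient

end Eis

/-! ### Functoriality of `PSL₂` and homomorphisms from `ℤ/3`. -/

theorem pslMap_pslMk {R R' : Type} [CommRing R] [CommRing R'] (f : R →+* R') (A : SL(2, R)) :
    pslMap f (pslMk A) = pslMk (Matrix.SpecialLinearGroup.map f A) := rfl

theorem pslMap_injective {R R' : Type} [CommRing R] [CommRing R'] [IsDomain R] [IsDomain R']
    {f : R →+* R'} (hf : Function.Injective f) : Function.Injective (pslMap f) := by
  rw [injective_iff_map_eq_one]
  intro p hp
  obtain ⟨A, rfl⟩ := pslMk_surjective p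
  have hinj : Function.Injective (Matrix.SpecialLinearGroup.map (n := Fin 2) f) := by
    intro A B hAB
    ext i j
    exact hf (congrArg (fun M : SL(2, R') => M.1 i j) hAB)
  rw [pslMap_pslMk, pslMk_eq_one_iff] at hp
  rw [pslMk_eq_one_iff]
  refine hp.imp (fun h => hinj (by rw [h, map_one])) fun h => hinj ?_
  rw [h]
  ext i j
  fin_cases i <;> fin_cases j <;> simp

theorem zmod3_hom_ext {G : Type} [Group G] {f g : Multiplicative (ZMod 3) →* G}
    (h : f (.ofAdd 1) = g (.ofAdd 1)) : f = g := by
  have key : ∀ x : Multiplicative (ZMod 3), ∃ k : Fin 3, x = .ofAdd 1 ^ k.val := by decide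
  refine MonoidHom.ext fun x => ?_
  obtain ⟨k, rfl⟩ := key x
  rw [map_pow, map_pow, h]

/-! ### Copies of the modular group -/

section Modular

variable {W : Type} [Group W] {s t : W}

theorem exists_modularHom (hs : s * s = 1) (hst : (s * t) ^ 3 = 1) :
    ∃ Φ : PSL(2, ℤ) →* W, Φ pslS = s ∧ ∀ b, Φ (pslT (.ofAdd b)) = t ^ b := by
  obtain ⟨Φ, hT, -, hS⟩ := exists_hom_psl isUnitEuclidean_int
    (elementaryRelations_int (T := zpowersHom W t) (D := 1) hs rfl (by simpa using hst))
  exact ⟨Φ, hS, fun b => by rw [hT, zpowersHom_apply, toAdd_ofAdd]⟩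

theorem modularHom_hom_ext {f g : PSL(2, ℤ) →* W} (hS : f pslS = g pslS)
    (hT : f (pslT (.ofAdd 1)) = g (pslT (.ofAdd 1))) : f = g := by
  refine psl_hom_ext isUnitEuclidean_int (fun b => ?_) (fun u => ?_) hS
  · have : b = .ofAdd 1 ^ b.toAdd := by
      rw [← ofAdd_zsmul]
      simp
    rw [this, map_zpow, map_zpow, map_zpow, hT]
  · have : pslD u = 1 := by
      rcases Int.units_eq_one_or u with rfl | rfl
      · exact map_one _
      · exact elementaryRelations_psl.D_neg_one
    rw [this, map_one, map_one]

theorem pslMap_pslS {R R' : Type} [CommRing R] [CommRing R'] (f : R →+* R') :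
    pslMap f pslS = pslS := by
  refine congrArg pslMk ?_
  ext i j
  fin_cases i <;> fin_cases j <;> simp

theorem pslMap_pslT {R R' : Type} [CommRing R] [CommRing R'] (f : R →+* R') (b : R) :
    pslMap f (pslT (.ofAdd b)) = pslT (.ofAdd (f b)) := by
  refine congrArg pslMk ?_
  ext i j
  fin_cases i <;> fin_cases j <;> simp

/-- Used to prove `Φ` injective: its composite with `g` is a conjugate of the inclusion of
`PSL₂(ℤ)`. -/
theorem comp_modularHom {Φ : PSL(2, ℤ) →* W} (hΦS : Φ pslS = s)
    (hΦT : ∀ b, Φ (pslT (.ofAdd b)) = t ^ b) {g : W →* PSL(2, Eis)} (c : PSL(2, Eis))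
    (hgs : g s = c * pslS * c⁻¹) (hgt : g t = c * pslMk (slT 1) * c⁻¹) :
    g.comp Φ = (MulAut.conj c).toMonoidHom.comp (pslMap (algebraMap ℤ Eis)) := by
  refine modularHom_hom_ext ?_ ?_
  · rw [MonoidHom.comp_apply, hΦS, hgs, MonoidHom.comp_apply, pslMap_pslS]
    rfl
  · rw [MonoidHom.comp_apply, hΦT, zpow_one, hgt, MonoidHom.comp_apply, pslMap_pslT, map_one]
    rfl

theorem injective_pslMap_int_eis : Function.Injective (pslMap (algebraMap ℤ Eis)) :=
  pslMap_injective QuadraticAlgebra.algebraMap_injective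

end Modular

/-! ### The amalgamated product -/

namespace K32

/-- A transposition of `S₃`, as an element of `K32`. -/
def S : K32 := Monoid.PushoutI.of (φ := factorMap) 0 (Equiv.swap (0 : Fin 3) 1)

/-- The generator `x` of `D(3,3,3)`, as an element of `K32`. -/
def X : K32 := Monoid.PushoutI.of (φ := factorMap) 1 (PresentedGroup.of (rels := relsD333) 0)

/-- The generator of the amalgamated subgroup. -/
def Y : K32 := Monoid.PushoutI.base factorMap (.ofAdd 1)

theorem factorMap_zero : factorMap 0 (.ofAdd 1) = (finRotate 3 : Equiv.Perm (Fin 3)) :=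
  zmod3Hom_ofAdd_one (finRotate 3) (by decide)

theorem factorMap_one : factorMap 1 (.ofAdd 1) = D333.y :=
  zmod3Hom_ofAdd_one D333.y D333.y_pow_three

theorem Y_eq_of_zero :
    Y = Monoid.PushoutI.of (φ := factorMap) 0 (finRotate 3 : Equiv.Perm (Fin 3)) := by
  rw [Y, ← Monoid.PushoutI.of_apply_eq_base factorMap 0]
  exact congrArg _ factorMap_zero

theorem Y_eq_of_one : Y = Monoid.PushoutI.of (φ := factorMap) 1 D333.y := by
  rw [Y, ← Monoid.PushoutI.of_apply_eq_base factorMap 1]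
  exact congrArg _ factorMap_one

theorem S_mul_S : S * S = 1 := by
  rw [S, ← map_mul]
  exact (congrArg _ (Equiv.swap_mul_self (0 : Fin 3) 1)).trans (map_one _)

theorem Y_pow : Y ^ 3 = 1 := by
  rw [Y_eq_of_one, ← map_pow]
  exact (congrArg _ D333.y_pow_three).trans (map_one _)

theorem Y_mul_S : Y * S = S * Y⁻¹ := by
  rw [Y_eq_of_zero, S, ← map_inv, ← map_mul, ← map_mul]
  exact congrArg _ (show finRotate 3 * Equiv.swap (0 : Fin 3) 1 =
    Equiv.swap (0 : Fin 3) 1 * (finRotate 3)⁻¹ by decide)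

theorem X_pow : X ^ 3 = 1 := by
  rw [X, ← map_pow]
  exact (congrArg _ (PresentedGroup.one_of_mem (rels := relsD333) (x := FreeGroup.of 0 ^ 3)
    (by simp [relsD333]))).trans (map_one _)

theorem XY_pow : (X * Y) ^ 3 = 1 := by
  rw [Y_eq_of_one, X, ← map_mul, ← map_pow]
  exact (congrArg _ (PresentedGroup.one_of_mem (rels := relsD333)
    (x := (FreeGroup.of 0 * FreeGroup.of 1) ^ 3) (by simp [relsD333]))).trans (map_one _)

/-- The homomorphism from `S₃` to `SL₂(ℤ[ω])` up to sign. -/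
def s3Matrix (σ : Equiv.Perm (Fin 3)) : SL(2, Eis) :=
  -- The `k`-th power of the rotation sends 0 to `k`; composed with the swap of 0 and 1 it sends 0
  -- to `k + 1`, so the exponent is recovered from `σ 0`.
  if Equiv.Perm.sign σ = 1 then Eis.slY ^ (σ 0).val else Eis.slY ^ (σ 0 - 1).val * slS

set_option maxRecDepth 10000 in
theorem s3Matrix_mul : ∀ σ τ, (s3Matrix (σ * τ)).1 = (s3Matrix σ * s3Matrix τ).1 ∨
    (s3Matrix (σ * τ)).1 = (-(s3Matrix σ * s3Matrix τ)).1 := by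
  decide

/-- The homomorphism from `S₃` to `PSL₂(ℤ[ω])`. -/
def s3Hom : Equiv.Perm (Fin 3) →* PSL(2, Eis) :=
  MonoidHom.mk' (fun σ => pslMk (s3Matrix σ)) fun σ τ => by
    rw [pslMk_eq_of_eq_or_eq_neg (s3Matrix_mul σ τ), map_mul]

/-- The homomorphism from `D(3,3,3)` to `PSL₂(ℤ[ω])`. -/
def d333Hom : D333 →* PSL(2, Eis) :=
  PresentedGroup.toGroup (rels := relsD333) (f := ![pslMk Eis.slX, pslMk Eis.slY]) (by
    have h := Eis.hnnRelations_psl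
    rintro r (rfl | rfl | rfl)
    · simpa using h.X_pow
    · simpa using h.Y_pow
    · simpa using h.XY_pow)

theorem d333Hom_of (k : Fin 2) :
    d333Hom (PresentedGroup.of k) = (![pslMk Eis.slX, pslMk Eis.slY] : Fin 2 → PSL(2, Eis)) k :=
  PresentedGroup.toGroup.of _

/-- The homomorphisms from the factors to `PSL₂(ℤ[ω])`. -/
def factorHom : (i : Fin 2) → Factor i →* PSL(2, Eis)
  | 0 => s3Hom
  | 1 => d333Hom

/-- The homomorphism from `K32` to `PSL₂(ℤ[ω])`. -/
def toPsl : K32 →* PSL(2, Eis) :=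
  Monoid.PushoutI.lift factorHom (zmod3Hom (pslMk Eis.slY) Eis.hnnRelations_psl.Y_pow) (by
    intro i
    apply zmod3_hom_ext
    rw [zmod3Hom_ofAdd_one]
    match i with
    | 0 => exact (congrArg s3Hom factorMap_zero).trans (congrArg pslMk (Subtype.ext (by decide)))
    | 1 => exact (congrArg d333Hom factorMap_one).trans (d333Hom_of 1))

theorem toPsl_S : toPsl S = pslMk slS := by
  rw [toPsl, S, Monoid.PushoutI.lift_of]
  exact congrArg pslMk (Subtype.ext (by decide))

theorem toPsl_X : toPsl X = pslMk Eis.slX := by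
  rw [toPsl, X, Monoid.PushoutI.lift_of]
  exact d333Hom_of 0

theorem toPsl_Y : toPsl Y = pslMk Eis.slY := by
  rw [toPsl, Y, Monoid.PushoutI.lift_base, zmod3Hom_ofAdd_one]

theorem closure_eq_top : Subgroup.closure {S, X, Y} = (⊤ : Subgroup K32) := by
  rw [eq_top_iff]
  have hY : Y ∈ Subgroup.closure {S, X, Y} := Subgroup.subset_closure (by simp)
  have hS : S ∈ Subgroup.closure {S, X, Y} := Subgroup.subset_closure (by simp)
  have hX : X ∈ Subgroup.closure {S, X, Y} := Subgroup.subset_closure (by simp)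
  have h3 : ∀ σ : Equiv.Perm (Fin 3), ∃ i j : Fin 3,
      σ = finRotate 3 ^ i.val * Equiv.swap (0 : Fin 3) 1 ^ j.val := by decide
  have key : ∀ (i : Fin 2) (g : Factor i), Monoid.PushoutI.of (φ := factorMap) i g ∈
      Subgroup.closure {S, X, Y} := by
    intro i g
    match i with
    | 0 =>
      obtain ⟨i, j, hg⟩ := h3 g
      have : Monoid.PushoutI.of (φ := factorMap) 0 g = Y ^ i.val * S ^ j.val := by
        rw [Y_eq_of_zero, S, ← map_pow, ← map_pow, ← map_mul]
        exact congrArg _ hg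
      rw [this]
      exact mul_mem (pow_mem hY _) (pow_mem hS _)
    | 1 =>
      have hle : (⊤ : Subgroup D333) ≤
          (Subgroup.closure {S, X, Y}).comap (Monoid.PushoutI.of (φ := factorMap) 1) := by
        rw [← PresentedGroup.closure_range_of relsD333, Subgroup.closure_le]
        rintro _ ⟨k, rfl⟩
        fin_cases k
        · exact hX
        · exact Y_eq_of_one ▸ hY
      exact hle (Subgroup.mem_top g)
  intro k _
  induction k using Monoid.PushoutI.induction_on with
  | of i g => exact key i g
  | base h =>
    rw [← Monoid.PushoutI.of_apply_eq_base factorMap 0]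
    exact key 0 _
  | mul x y hx hy => exact mul_mem (hx trivial) (hy trivial)

end K32

namespace K32

theorem zmod3Hom_injective {G : Type} [Group G] {g : G} (hg : g ^ 3 = 1) (h : g ≠ 1) :
    Function.Injective (zmod3Hom g hg) := by
  rw [injective_iff_map_eq_one]
  intro x hx
  have key : ∀ x : Multiplicative (ZMod 3), x = 1 ∨ ∃ k : Fin 3, .ofAdd 1 = x ^ k.val := by decide
  rcases key x with hx1 | ⟨k, hk⟩
  · exact hx1
  · refine absurd ?_ h
    rw [← zmod3Hom_ofAdd_one g hg, hk, map_pow, hx, one_pow]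

/-- The amalgamated `ℤ/3` already survives in `PSL₂(ℤ[ω])`, because the matrix of `Y` is not `±1`;
hence it survives in each factor. -/
theorem factorMap_injective (i : Fin 2) : Function.Injective (factorMap i) := by
  have h : Function.Injective (toPsl.comp (Monoid.PushoutI.base factorMap)) := by
    have : toPsl.comp (Monoid.PushoutI.base factorMap) =
        zmod3Hom (pslMk Eis.slY) Eis.hnnRelations_psl.Y_pow := by
      refine MonoidHom.ext fun x => ?_
      rw [MonoidHom.comp_apply, toPsl, Monoid.PushoutI.lift_base]
    rw [this]
    refine zmod3Hom_injective _ fun h => ?_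
    rw [pslMk_eq_one_iff] at h
    revert h
    decide
  rw [← Monoid.PushoutI.of_comp_eq_base (φ := factorMap) i] at h
  exact Function.Injective.of_comp (f := toPsl.comp (Monoid.PushoutI.of (φ := factorMap) i)) h

/-- The pairs `(S, XS)` and `(SY, XS)` both satisfy the modular relations: `S(XS)` is conjugate to
`X` and `(SY)(XS)` to `XY`. In `PSL₂(ℤ[ω])` they generate the standard modular group and its
conjugate by the translation by `√-3`, which commutes with `XS = T(1)`. -/
theorem exists_modular_embeddings : ∃ j j' : PSL(2, ℤ) →* K32,
    Function.Injective j ∧ Function.Injective j' ∧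
    (∀ p, pslMk Eis.slW * toPsl (j p) = toPsl (j' p) * pslMk Eis.slW) ∧
    j pslS = S ∧ j' pslS = S * Y ∧
    j (pslT (.ofAdd 1)) = X * S ∧ j' (pslT (.ofAdd 1)) = X * S := by
  have hr := Eis.hnnRelations_psl
  have hXS : (S * (X * S)) ^ 3 = 1 := by
    have : S * (X * S) = S * X * S⁻¹ := by rw [inv_eq_of_mul_eq_one_left S_mul_S, mul_assoc]
    rw [this, conj_pow, X_pow, mul_one, mul_inv_cancel]
  have hSY : S * Y * (S * Y) = 1 := by
    rw [mul_assoc, ← mul_assoc Y, Y_mul_S, inv_mul_cancel_right, S_mul_S]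
  have hSYXS : (S * Y * (X * S)) ^ 3 = 1 := by
    have : S * Y * (X * S) = S * Y * (X * Y) * (S * Y)⁻¹ := by
      rw [mul_inv_rev, inv_eq_of_mul_eq_one_left S_mul_S]
      simp only [mul_assoc, mul_inv_cancel_left]
    rw [this, conj_pow, XY_pow, mul_one, mul_inv_cancel]
  obtain ⟨j, hjS, hjT⟩ := exists_modularHom S_mul_S hXS
  obtain ⟨j', hjS', hjT'⟩ := exists_modularHom hSY hSYXS
  have hT : pslMk Eis.slX * pslMk slS = pslMk (slT 1) := by
    rw [← map_mul]
    exact pslMk_eq_of_eq_or_eq_neg (by decide)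
  have hc := comp_modularHom hjS hjT (g := toPsl) 1 (by rw [toPsl_S]; simp [pslS])
    (by rw [map_mul, toPsl_S, toPsl_X, hT]; simp)
  have hc' := comp_modularHom hjS' hjT' (g := toPsl) (pslMk Eis.slW)
    (by rw [map_mul, toPsl_S, toPsl_Y, eq_mul_inv_iff_mul_eq]; exact hr.w_mul_S.symm)
    (by
      rw [map_mul, toPsl_S, toPsl_X, hT, eq_mul_inv_iff_mul_eq, ← map_mul, ← map_mul]
      exact pslMk_eq_of_eq_or_eq_neg (by decide))
  have hι : Function.Injective (pslMap (algebraMap ℤ Eis)) := injective_pslMap_int_eis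
  refine ⟨j, j', ?_, ?_, fun p => ?_, hjS, hjS', by rw [hjT, zpow_one], by rw [hjT', zpow_one]⟩
  · have : Function.Injective (toPsl.comp j) := by
      rw [hc]
      exact (MulAut.conj _).injective.comp hι
    exact Function.Injective.of_comp (f := toPsl) this
  · have : Function.Injective (toPsl.comp j') := by
      rw [hc']
      exact (MulAut.conj _).injective.comp hι
    exact Function.Injective.of_comp (f := toPsl) this
  · have h1 := DFunLike.congr_fun hc p
    have h2 := DFunLike.congr_fun hc' p
    simp only [MonoidHom.comp_apply] at h1 h2
    rw [h1, h2]
    simp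

end K32

/-! ### The HNN-extension. -/

/-- A subgroup of `PSL₂(ℤ[ω])` that consists of the matrices with entries in `ℤ[√-3]` is an
HNN-extension of `K32` with associated subgroups isomorphic to the modular group. -/
theorem exists_hnnExtension {H : Subgroup PSL(2, Eis)}
    (hH : ∀ A, pslMk A ∈ H ↔ ∀ i j, 2 ∣ (A.1 i j).im) :
    H.FiniteIndex ∧ ∃ (A B : Subgroup K32) (φ : A ≃* B),
      Nonempty (A ≃* PSL(2, ℤ)) ∧ Nonempty (B ≃* PSL(2, ℤ)) ∧
      Nonempty (H ≃* HNNExtension K32 A B φ) := by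
  obtain ⟨j, j', hj, hj', hconj, hjS, hjS', hjT, hjT'⟩ := K32.exists_modular_embeddings
  let eA := j.ofInjective hj
  let eB := j'.ofInjective hj'
  let φ : j.range ≃* j'.range := eA.symm.trans eB
  have hφ (p : PSL(2, ℤ)) : φ (eA p) = eB p := by
    show eB (eA.symm (eA p)) = eB p
    rw [MulEquiv.symm_apply_apply]
  let f : HNNExtension K32 j.range j'.range φ →* PSL(2, Eis) :=
    HNNExtension.lift K32.toPsl (pslMk Eis.slW) (by
      intro a
      obtain ⟨p, rfl⟩ := eA.surjective a
      rw [hφ]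
      exact hconj p)
  let ι : K32 →* HNNExtension K32 j.range j'.range φ := HNNExtension.of
  let w : HNNExtension K32 j.range j'.range φ := HNNExtension.t
  have hw (p : PSL(2, ℤ)) : w * ι (j p) = ι (j' p) * w := by
    have := HNNExtension.t_mul_of (φ := φ) (eA p)
    rw [hφ] at this
    exact this
  have hwS : w * ι K32.S = ι K32.S * ι K32.Y * w := by
    have := hw pslS
    rwa [hjS, hjS', map_mul] at this
  have hrel : HNNRelations (ι K32.S) (ι K32.X) (ι K32.Y) w :=
    { S_mul_S := by rw [← map_mul, K32.S_mul_S, map_one]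
      X_pow := by rw [← map_pow, K32.X_pow, map_one]
      Y_pow := by rw [← map_pow, K32.Y_pow, map_one]
      Y_mul_S := by rw [← map_inv, ← map_mul, ← map_mul, K32.Y_mul_S]
      XY_pow := by rw [← map_mul, ← map_pow, K32.XY_pow, map_one]
      w_mul_S := hwS
      w_mul_X := by
        -- `T(1)S` goes to `XS·S = X` under `j` and to `XS·SY = XY` under `j'`.
        have h1 := hw (pslT (.ofAdd 1) * pslS)
        have h2 : K32.X * K32.S * K32.S = K32.X := by rw [mul_assoc, K32.S_mul_S, mul_one]
        have h3 : K32.X * K32.S * (K32.S * K32.Y) = K32.X * K32.Y := by rw [← mul_assoc, h2]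
        rwa [map_mul j, map_mul j', hjS, hjS', hjT, hjT', h2, h3, map_mul ι] at h1 }
  have hfS : f (ι K32.S) = pslMk slS := (HNNExtension.lift_of _ _ _ _).trans K32.toPsl_S
  have hfX : f (ι K32.X) = pslMk Eis.slX := (HNNExtension.lift_of _ _ _ _).trans K32.toPsl_X
  have hfw : f w = pslMk Eis.slW := HNNExtension.lift_t _ _ _
  have hG : Subgroup.closure {ι K32.S, ι K32.X, w} = ⊤ := by
    rw [eq_top_iff]
    have mS : ι K32.S ∈ Subgroup.closure {ι K32.S, ι K32.X, w} := Subgroup.subset_closure (by simp)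
    have mX : ι K32.X ∈ Subgroup.closure {ι K32.S, ι K32.X, w} := Subgroup.subset_closure (by simp)
    have mw : w ∈ Subgroup.closure {ι K32.S, ι K32.X, w} := Subgroup.subset_closure (by simp)
    have mY : ι K32.Y ∈ Subgroup.closure {ι K32.S, ι K32.X, w} := by
      have : ι K32.Y = ι K32.S * (w * ι K32.S * w⁻¹) := by
        rw [hwS, mul_inv_cancel_right, ← mul_assoc, hrel.S_mul_S, one_mul]
      rw [this]
      exact mul_mem mS (mul_mem (mul_mem mw mS) (inv_mem mw))
    have mK : (⊤ : Subgroup K32) ≤ (Subgroup.closure {ι K32.S, ι K32.X, w}).comap ι := by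
      rw [← K32.closure_eq_top, Subgroup.closure_le]
      rintro _ (rfl | rfl | rfl)
      exacts [mS, mX, mY]
    intro g _
    induction g using HNNExtension.induction_on with
    | of g => exact mK (Subgroup.mem_top g)
    | t => exact mw
    | mul x y hx hy => exact mul_mem (hx trivial) (hy trivial)
    | inv x hx => exact inv_mem (hx trivial)
  have hrange := Eis.range_eq hrel hfS hfX hfw hH hG
  have hinj := Eis.injective_of_hnnRelations hrel hfS hfX hfw hG
  refine ⟨hrange ▸ Eis.finiteIndex_range hrel hfS hfX hfw, j.range, j'.range, φ, ⟨eA.symm⟩,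
    ⟨eB.symm⟩, ⟨?_⟩⟩
  exact (MulEquiv.subgroupCongr hrange.symm).trans (f.ofInjective hinj).symm

/-! ### The ring of integers of `ℚ(√-3)` -/

/-- The homomorphism from the Eisenstein integers to the ring of integers of `ℚ(√-3)`. -/
def eisToO3 : Eis →+* O3 :=
  (QuadraticAlgebra.lift ⟨omega, by
    rw [← pow_two, omega_sq]
    simp [sub_eq_neg_add]⟩ : Eis →ₐ[ℤ] O3).toRingHom

theorem eisToO3_apply (x : Eis) : eisToO3 x = (x.re : O3) + (x.im : O3) * omega := by
  simp [eisToO3, QuadraticAlgebra.lift, zsmul_eq_mul]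

theorem coe_eisToO3 (x : Eis) : ((eisToO3 x : QSqrtNeg3) : ℂ) = x.re + x.im * omegaC := by
  rw [eisToO3_apply]
  push_cast
  rfl

theorem omegaC_im : omegaC.im = Real.sqrt 3 / 2 := by
  simp [omegaC]

theorem omegaC_re : omegaC.re = 1 / 2 := by
  simp [omegaC]

theorem eisToO3_injective : Function.Injective eisToO3 := by
  rw [injective_iff_map_eq_zero]
  intro x hx
  have h := coe_eisToO3 x
  rw [hx] at h
  have him := congrArg Complex.im h
  have hre := congrArg Complex.re h
  simp [omegaC_im, omegaC_re] at him hre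
  rw [him] at hre
  ext
  · simpa using hre.symm
  · simpa using him

/-- `X² - X + 1` has no rational root, so the quadratic algebra is a field; its image in `ℂ` is a
subfield containing `√-3 = 2ω - 1`. -/
theorem exists_rat_add_rat_mul_omegaC {z : ℂ} (hz : z ∈ QSqrtNeg3) :
    ∃ p q : ℚ, z = p + q * omegaC := by
  have : Fact (∀ r : ℚ, r ^ 2 ≠ -1 + 1 * r) := ⟨fun r h => by nlinarith [sq_nonneg (2 * r - 1)]⟩
  let F : QuadraticAlgebra ℚ (-1) 1 →ₐ[ℚ] ℂ := QuadraticAlgebra.lift ⟨omegaC, by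
    rw [← pow_two, omegaC_sq]
    simp [sub_eq_neg_add]⟩
  have hF (x) : F x = (x.re : ℂ) + x.im * omegaC := by
    rw [show F x = x.re • (1 : ℂ) + x.im • omegaC from rfl]
    simp [Algebra.smul_def]
  have hle : QSqrtNeg3 ≤ F.fieldRange := by
    rw [IntermediateField.adjoin_le_iff, Set.singleton_subset_iff]
    refine ⟨⟨-1, 2⟩, ?_⟩
    show F _ = _
    rw [hF, omegaC]
    push_cast
    ring
  obtain ⟨x, rfl⟩ := hle hz
  exact ⟨x.re, x.im, hF x⟩

/-- The trace `m = 2p + q` and the norm `n = p² + pq + q²` are integers with `m² + 3q² = 4n`. Thus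
`(3q)²` is an integer divisible by 3, which makes `q` an integer, and then `m` and `q` have equal
parity. -/
theorem exists_int_of_isIntegral_rat {p q : ℚ} (h : IsIntegral ℤ ((p : ℂ) + q * omegaC)) :
    ∃ a b : ℤ, p = a ∧ q = b := by
  have hconj : IsIntegral ℤ ((p : ℂ) + q * (1 - omegaC)) := by
    have := h.map (starRingEnd ℂ).toIntAlgHom
    have e : (starRingEnd ℂ).toIntAlgHom ((p : ℂ) + q * omegaC) = (p : ℂ) + q * (1 - omegaC) := by
      show (starRingEnd ℂ) _ = _
      have h2 : (starRingEnd ℂ) 2 = 2 := map_ofNat _ 2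
      simp only [omegaC, map_add, map_mul, map_div₀, map_one, map_ratCast, Complex.conj_ofReal,
        Complex.conj_I, h2]
      ring
    rwa [e] at this
  have hrat {r : ℚ} {z : ℂ} (hz : IsIntegral ℤ z) (hr : z = r) : ∃ m : ℤ, r = m := by
    rw [hr] at hz
    have h1 : IsIntegral ℤ r := by
      have : Function.Injective (algebraMap ℚ ℂ) := (algebraMap ℚ ℂ).injective
      exact (isIntegral_algebraMap_iff this).1 hz
    obtain ⟨m, hm⟩ := IsIntegrallyClosed.isIntegral_iff.1 h1
    exact ⟨m, hm.symm⟩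
  obtain ⟨m, hm⟩ := hrat (r := 2 * p + q) (h.add hconj) (by push_cast; ring)
  obtain ⟨n, hn⟩ := hrat (r := p ^ 2 + p * q + q ^ 2) (h.mul hconj) (by
    push_cast
    linear_combination (-(q : ℂ) ^ 2) * omegaC_sq)
  have hq : (3 * q) ^ 2 = ((3 * (4 * n - m ^ 2) : ℤ) : ℚ) := by
    push_cast
    rw [← hm, ← hn]
    ring
  obtain ⟨r, hr⟩ : ∃ r : ℤ, 3 * q = r := by
    have h1 : IsIntegral ℤ (3 * q) := by
      refine IsIntegral.of_pow (n := 2) (by norm_num) ?_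
      rw [hq]
      exact isIntegral_algebraMap
    obtain ⟨m, hm⟩ := IsIntegrallyClosed.isIntegral_iff.1 h1
    exact ⟨m, hm.symm⟩
  rw [hr] at hq
  have hq' : r ^ 2 = 3 * (4 * n - m ^ 2) := by exact_mod_cast hq
  obtain ⟨b, rfl⟩ : 3 ∣ r := Int.prime_three.dvd_of_dvd_pow ⟨_, hq'⟩
  have hb : q = b := by
    push_cast at hr
    linarith
  have hmb : m ^ 2 + 3 * b ^ 2 = 4 * n := by nlinarith
  have h2 : (2 : ℤ) ∣ m - b := by
    have h4 : (m ^ 2 + 3 * b ^ 2) % 2 = 0 := by omega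
    rcases Int.emod_two_eq_zero_or_one m with h5 | h5 <;>
      rcases Int.emod_two_eq_zero_or_one b with h6 | h6 <;>
      simp [pow_two, Int.add_emod, Int.mul_emod, h5, h6] at h4 <;> omega
  obtain ⟨a, ha⟩ := h2
  refine ⟨a, b, ?_, hb⟩
  have : (m : ℚ) - b = 2 * a := by exact_mod_cast ha
  linarith

theorem eisToO3_surjective : Function.Surjective eisToO3 := by
  intro x
  obtain ⟨p, q, hpq⟩ := exists_rat_add_rat_mul_omegaC (x : QSqrtNeg3).2
  have hint : IsIntegral ℤ ((x : QSqrtNeg3) : ℂ) := by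
    have := NumberField.RingOfIntegers.isIntegral_coe x
    exact this.map (QSqrtNeg3.val.restrictScalars ℤ)
  rw [hpq] at hint
  obtain ⟨a, b, rfl, rfl⟩ := exists_int_of_isIntegral_rat hint
  refine ⟨⟨a, b⟩, NumberField.RingOfIntegers.ext (Subtype.ext ?_)⟩
  rw [coe_eisToO3, hpq]
  push_cast
  rfl

/-- The ring of integers of `ℚ(√-3)` is the ring of Eisenstein integers. -/
def eisEquivO3 : Eis ≃+* O3 :=
  RingEquiv.ofBijective eisToO3 ⟨eisToO3_injective, eisToO3_surjective⟩

theorem eisEquivO3_mem_iff (x : Eis) : eisEquivO3 x ∈ O3m 2 ↔ 2 ∣ x.im := by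
  have h (a b : ℤ) : ((a : O3) + (2 : ℕ) * omega * (b : O3)) = eisEquivO3 ⟨a, 2 * b⟩ := by
    show _ = eisToO3 _
    rw [eisToO3_apply]
    push_cast
    ring
  constructor
  · rintro ⟨a, b, hx⟩
    rw [h] at hx
    rw [eisEquivO3.injective hx]
    exact ⟨b, rfl⟩
  · rintro ⟨b, hb⟩
    refine ⟨x.re, b, ?_⟩
    rw [h, ← hb]

/-- The isomorphism of `PSL₂` over the Eisenstein integers with `PSL₂` over `O₃`. -/
def pslEisEquiv : PSL(2, Eis) ≃* PSL(2, O3) :=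
  MulEquiv.ofBijective (pslMap eisEquivO3.toRingHom)
    ⟨pslMap_injective eisEquivO3.injective, fun p => by
      obtain ⟨A, rfl⟩ := pslMk_surjective p
      refine ⟨pslMk (Matrix.SpecialLinearGroup.map eisEquivO3.symm.toRingHom A), ?_⟩
      rw [pslMap_pslMk]
      congr 1
      ext i j
      simp⟩

theorem mem_comap_gamma32_iff (A : SL(2, Eis)) :
    pslMk A ∈ Gamma32.comap pslEisEquiv.toMonoidHom ↔ ∀ i j, 2 ∣ (A.1 i j).im := by
  have hmk : pslEisEquiv (pslMk A) =
    pslMk (Matrix.SpecialLinearGroup.map eisEquivO3.toRingHom A) := rfl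
  rw [Subgroup.mem_comap]
  show pslEisEquiv (pslMk A) ∈ _ ↔ _
  rw [hmk]
  simp only [← eisEquivO3_mem_iff]
  constructor
  · rintro ⟨p, hp⟩
    obtain ⟨B, rfl⟩ := pslMk_surjective p
    -- A class in the image determines its matrix only up to sign, which is harmless since the order
    -- is closed under negation.
    rw [pslMap_pslMk, ← inv_mul_eq_one, ← map_inv, ← map_mul, pslMk_eq_one_iff] at hp
    intro i j
    have hB : ((Matrix.SpecialLinearGroup.map (O3m 2).subtype B).1 i j) ∈ O3m 2 := (B.1 i j).2
    rcases hp with hp | hp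
    · rw [inv_mul_eq_one] at hp
      rw [hp] at hB
      exact hB
    · rw [inv_mul_eq_iff_eq_mul, mul_neg, mul_one] at hp
      have : eisEquivO3 (A.1 i j) = -((Matrix.SpecialLinearGroup.map (O3m 2).subtype B).1 i j) :=
        congrArg (fun M : SL(2, O3) => M.1 i j) hp
      rw [this]
      exact neg_mem hB
  · intro h
    let M : Matrix (Fin 2) (Fin 2) (O3m 2) := fun i j => ⟨eisEquivO3 (A.1 i j), h i j⟩
    have hM : M.det = 1 := by
      have h1 := congrArg eisEquivO3 A.2
      rw [Matrix.det_fin_two, map_sub, map_mul, map_mul, map_one] at h1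
      rw [Matrix.det_fin_two]
      exact Subtype.ext h1
    exact ⟨pslMk ⟨M, hM⟩, rfl⟩

end

theorem proposition3p1 :
    -- The group `PSL₂(O_{3,2})` embeds in `Γ₃` as a subgroup `Γ_{3,2}` of finite index.
    Function.Injective (pslMap (O3m 2).subtype) ∧ Gamma32.FiniteIndex ∧
    -- `K_{3,2}` is a genuine amalgamated free product.
    (∀ i, Function.Injective (factorMap i)) ∧
    -- `Γ_{3,2}` is an HNN-extension of `K_{3,2}` with associated subgroups `A` and `B`.
    ∃ (A B : Subgroup K32) (φ : A ≃* B),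
      Nonempty (A ≃* PSL(2, ℤ)) ∧ Nonempty (B ≃* PSL(2, ℤ)) ∧
      Nonempty (Gamma32 ≃* HNNExtension K32 A B φ) := by
  obtain ⟨hfin, A, B, φ, hA, hB, ⟨e⟩⟩ := exists_hnnExtension mem_comap_gamma32_iff
  have hmap : (Gamma32.comap pslEisEquiv.toMonoidHom).map pslEisEquiv.toMonoidHom = Gamma32 :=
    Subgroup.map_comap_eq_self_of_surjective pslEisEquiv.surjective _
  refine ⟨pslMap_injective Subtype.val_injective, ?_, K32.factorMap_injective, A, B, φ, hA, hB,
    ⟨?_⟩⟩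
  · refine ⟨?_⟩
    rw [← Subgroup.index_comap_of_surjective Gamma32 (f := pslEisEquiv.toMonoidHom)
      pslEisEquiv.surjective]
    exact hfin.index_ne_zero
  · exact ((MulEquiv.subgroupCongr hmap.symm).trans
      (pslEisEquiv.subgroupMap (Gamma32.comap pslEisEquiv.toMonoidHom)).symm).trans e
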